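/- Let $\mathcal X,\mathcal Y$ be finite alphabets and let $W=W_{Y|X}$ be a channel (stochastic matrix) with $W(y|x)>0$ for all $x,y$. Logarithms are natural. Let $b>a>0$. For $f:[0,\infty)\to\mathbb R$ and distributions $p\ll q$ on $\mathcal Y$ put $D_f(p\|q)=\sum_y q(y)f\bigl(p(y)/q(y)\bigr)$, where letters with $p(y)=q(y)=0$ contribute $0$. For an input distribution $p_X$ put $$I_{G,f}(X;Y)=\inf_{q_Y}\sum_x p_X(x)\,G\bigl(D_f(W_{Y|X=x}\|q_Y)\bigr),$$ the infimum being over the distributions $q_Y$ on $\mathcal Y$ with $W_{Y|X=x}\ll q_Y$ whenever $p_X(x)>0$. Throughout, $G(x)=-\log(1-x)$. Let $\mathcal T^-$ be the set of all $g:[0,\infty)\to[0,\infty)$, twice differentiable on $(0,\infty)$, such that $x^2g''(x)+g(\alpha)g(x/\alpha)\le 0$ for all $x\ge 0$ and $\alpha>0$ (the first term being $0$ at $x=0$). For $s\in(0,1)$ let $\psi_s:\mathbb R\to[a,b]$ satisfy $\psi_s(0)=1$, and suppose that $f_s(x)=x^s\psi_s(\log x)$, $f_s(0)=0$, is twice differentiable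 on $(0,\infty)$ and that $-x^2f_s''(x)\in\mathcal T^-$ (with value $0$ at $x=0$). Put $\widetilde f_s(x)=x\bigl(1-f_s(1/x)\bigr)$, $\widetilde f_s(0)=0$, and for $R\in\mathbb R$ $$E_{f\text{-}\mathrm{sp}}(R)=\sup_{p_X}\ \sup_{s\in(0,1)}\left[\frac{I_{G,\widetilde f_s}(X;Y)}{1-s}-\frac{s}{1-s}R\right]\in[-\infty,\infty].$$ A code of blocklength $n\ge1$ with $M$ messages consists of an encoder $\{1,\dots,M\}\to\mathcal X^n$ and a decoder $\mathcal Y^n\to\{1,\dots,M\}$; its rate is $\frac1n\log M$, and $P_e^{\max}$ is the maximum over the messages $m$ of the probability that the decoder does not output $m$ when $m$ is sent over the memoryless channel $W$. The reliability function at rate $R$ is $$\mathscr E(R)=\limsup_{n\to\infty}\ \sup\left\{\frac{-\log P_e^{\max}}{n}\ :\ \text{codes of blocklength } n \text{ with } M\ge e^{nR}\right\}.$$ Then there are constants $A,B$, depending only on $W$, $a$ and $b$, such that for every such family $(\psi_s)_{s\in(0,1)}$: 1. every code of blocklength $n\ge 1$ and rate $R=\frac1n\log M>0$ satisfies $$P_e^{\max}>\exp\left\{-n\left(E_{f\text{-}\mathrm{sp}}\left(R-\frac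 An\right)+\frac{B}{\sqrt n}\right)\right\},$$ with the convention $\exp(-\infty)=0$; 2. $\mathscr E(R)\le E_{f\text{-}\mathrm{sp}}(R)$ for every $R>0$. -/

import Mathlib

open Filter Set

noncomputable section

namespace SpherePacking

/-- The `f`-divergence `D_f(p‖q) = ∑ q f(p/q)` on a finite alphabet, for `p ≪ q`. A letter with
`q = p = 0` contributes `0`. -/
def fDiv {Y : Type*} [Fintype Y] (f : ℝ → ℝ) (p q : Y → ℝ) : ℝ :=
  ∑ y, q y * f (p y / q y)

/-- The `(G, f)`-information of the input distribution `p` and the channel `W`: the infimum of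
`∑ p(x) G(D_f(W(·|x)‖q))` over the output distributions `q` for which these divergences are
defined, i.e. `W(·|x) ≪ q` for all `x` with `p(x) ≠ 0`. -/
def gfInfo {X Y : Type*} [Fintype X] [Fintype Y] (G f : ℝ → ℝ) (p : X → ℝ) (W : X → Y → ℝ) :
    EReal :=
  ⨅ q ∈ {q : Y → ℝ | q ∈ stdSimplex ℝ Y ∧ ∀ x, p x ≠ 0 → ∀ y, q y = 0 → W x y = 0},
    ((∑ x, p x * G (fDiv f (W x) q) : ℝ) : EReal)

/-- `G(x) = -log(1 - x)`. -/
def negLogOneSub (x : ℝ) : ℝ := -Real.log (1 - x)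

/-- `f_s(x) = x ^ s ψ_s(log x)`; in particular `f_s(0) = 0` for `s > 0`. -/
def genFun (ψ : ℝ → ℝ → ℝ) (s x : ℝ) : ℝ := x ^ s * ψ s (Real.log x)

/-- `f̃(x) = x (1 - f(1/x))`, with `f̃(0) = 0`. -/
def tildeFun (f : ℝ → ℝ) (x : ℝ) : ℝ := x * (1 - f (1 / x))

/-- The class `𝒯⁻` of functions `g : [0,∞) → [0,∞)`, twice differentiable on `(0,∞)`, with
`x² g''(x) + g(α) g(x/α) ≤ 0` for all `x ≥ 0` and `α > 0`. At `x = 0` the first term is `0`. -/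
def TMinus : Set (ℝ → ℝ) :=
  {g | (∀ x, 0 ≤ x → 0 ≤ g x) ∧
    DifferentiableOn ℝ g (Ioi 0) ∧ DifferentiableOn ℝ (deriv g) (Ioi 0) ∧
    ∀ x, 0 ≤ x → ∀ α, 0 < α → x ^ 2 * deriv (deriv g) x + g α * g (x / α) ≤ 0}

/-- The family `ψ_s`, `s ∈ (0,1)`, is admissible for the bounds `a, b`: `ψ_s` takes values in
`[a, b]`, `ψ_s(0) = 1`, `f_s` is twice differentiable on `(0,∞)`, and `-x² f_s''(x)` lies in
`𝒯⁻`. -/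
def Admissible (a b : ℝ) (ψ : ℝ → ℝ → ℝ) : Prop :=
  ∀ s ∈ Ioo (0 : ℝ) 1,
    (∀ t, ψ s t ∈ Icc a b) ∧ ψ s 0 = 1 ∧
    DifferentiableOn ℝ (genFun ψ s) (Ioi 0) ∧ DifferentiableOn ℝ (deriv (genFun ψ s)) (Ioi 0) ∧
    (fun x => -(x ^ 2 * deriv (deriv (genFun ψ s)) x)) ∈ TMinus

/-- The exponent `E_{f-sp}(R)` of the channel `W`, with values in `[-∞, ∞]`. -/
def spExponent {X Y : Type*} [Fintype X] [Fintype Y] (ψ : ℝ → ℝ → ℝ) (W : X → Y → ℝ) (R : ℝ) :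
    EReal :=
  ⨆ p ∈ stdSimplex ℝ X, ⨆ s ∈ Ioo (0 : ℝ) 1,
    (gfInfo negLogOneSub (tildeFun (genFun ψ s)) p W / ((1 - s : ℝ) : EReal)
      - ((s / (1 - s) * R : ℝ) : EReal))

/-- A block code with blocklength `n` and `M` messages. -/
structure BlockCode (X Y : Type*) (n M : ℕ) where
  /-- the encoder -/
  enc : Fin M → Fin n → X
  /-- the decoder -/
  dec : (Fin n → Y) → Fin M

/-- The rate `(1/n) log M`. -/
def codeRate (n M : ℕ) : ℝ := Real.log M / n

/-- The probability `Pr(M̂ ≠ m | M = m)` over the memoryless channel `W`. -/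
def errorProb {X Y : Type*} [Fintype Y] (W : X → Y → ℝ) {n M : ℕ} (c : BlockCode X Y n M)
    (m : Fin M) : ℝ :=
  ∑ y : Fin n → Y with c.dec y ≠ m, ∏ i, W (c.enc m i) (y i)

/-- The maximal error probability (a maximum over the finitely many messages). -/
def maxErrorProb {X Y : Type*} [Fintype Y] (W : X → Y → ℝ) {n M : ℕ} (c : BlockCode X Y n M) : ℝ :=
  ⨆ m, errorProb W c m

/-- The reliability function (maximal error exponent) at rate `R`: the limit superior, as
`n → ∞`, of the best value of `-(1/n) log P_e^max` over all codes of blocklength `n` with at least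
`exp(nR)` messages. -/
def reliability {X Y : Type*} [Fintype Y] (W : X → Y → ℝ) (R : ℝ) : EReal :=
  limsup (fun n : ℕ =>
    ⨆ (M : ℕ) (_ : Real.exp (n * R) ≤ M) (c : BlockCode X Y n M),
      -ENNReal.log (ENNReal.ofReal (maxErrorProb W c)) / (n : EReal)) atTop

end SpherePacking

end

noncomputable section

namespace SpherePacking

/-! Every admissible exponent dominates the classical sphere-packing exponent, and the classical
exponent obeys the asserted bound with constants coming from `W` alone. This is why `A` and `B` are
uniform in `ψ`.

Domination: the inequality defining `TMinus` makes E f_s supermultiplicative over independent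
positive variables of mean 1. Since f_s(x) and x^s differ by a bounded factor, tensorizing gives (E
f_s(Y))^n ≤ b (E Y^s)^n for all n, and n-th roots remove b (`Admissible.sum_genFun_le`). For Y = q /
W_x the right side is the Chernoff coefficient, so the (G, f)-information is at least its Rényi
counterpart (`coe_le_gfInfo`).

Classical bound: put θ = 1 - s. Sion's theorem gives an output law q, bounded below, such that the
tilt V_x of W_x towards q satisfies D(V_x‖W_x) + (1/θ - 1) D(V_x‖q) ≤ E(s) for every letter x. If
the sum of D(V‖q) along a codeword lies just below log M, a decoding region that is small under q is
also not too large under V, and a change of measure bounds the error below by about exp(-∑ D(V‖W)).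
The displayed inequality turns this into n E(s) - s/(1-s) log M.

The suitable θ depends on the codeword, and no continuity of q in s is used. Instead the laws at the
grid θ_j = √((j+1)/n) are joined by segments, and a discrete intermediate value argument finds a
division point with the right sum. A weighted pigeonhole first picks one message that works for all
division points, so codewords of different composition need no separation. The likelihood ratios of
V and q have logarithm O(θ), so rate fluctuations are O(θ√n), and the slope 1/θ - 1 turns them into
O(√n) (`IsMinimaxExponent.exists_lt_errorProb`). -/

lemma sum_prod_apply {κ : Type*} [Fintype κ] {n : ℕ} (F : Fin n → κ → ℝ) :
    ∑ z : Fin n → κ, ∏ k, F k (z k) = ∏ k, ∑ j, F k j := by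
  classical
  rw [Finset.prod_univ_sum, Fintype.piFinset_univ]

/-! ### Supermultiplicativity of E f from the class `TMinus` -/

section Tensorization

variable {f : ℝ → ℝ}

/-- Jensen for y ↦ g(αy) - g(α) f(y), which vanishes at y = 1. Its second derivative times y² is
(αy)² g''(αy) + g(α) g(y), nonpositive by the `TMinus` inequality at the point αy. -/
lemma sum_mul_comp_le_of_mem_TMinus (hf1 : f 1 = 1) (hf : DifferentiableOn ℝ f (Ioi 0))
    (hf' : DifferentiableOn ℝ (deriv f) (Ioi 0)) {g : ℝ → ℝ}
    (hgf : ∀ x, g x = -(x ^ 2 * deriv (deriv f) x)) (hg : g ∈ TMinus)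
    {κ : Type*} [Fintype κ] (Q Y : κ → ℝ) (hQ : ∀ j, 0 ≤ Q j) (hQ1 : ∑ j, Q j = 1)
    (hY : ∀ j, 0 < Y j) (hQY : ∑ j, Q j * Y j = 1) {α : ℝ} (hα : 0 < α) :
    ∑ j, Q j * g (α * Y j) ≤ g α * ∑ j, Q j * f (Y j) := by
  obtain ⟨-, hg1, hg2, hineq⟩ := hg
  have dat : ∀ {h : ℝ → ℝ}, DifferentiableOn ℝ h (Ioi 0) → ∀ {x : ℝ}, 0 < x →
      HasDerivAt h (deriv h x) x := fun hh x hx =>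
    (hh.differentiableAt (Ioi_mem_nhds hx)).hasDerivAt
  have hconc : ConcaveOn ℝ (Ioi (0 : ℝ)) fun y => g (α * y) - g α * f y := by
    refine concaveOn_of_hasDerivWithinAt2_nonpos (convex_Ioi 0)
      (f' := fun y => deriv g (α * y) * α - g α * deriv f y)
      (f'' := fun y => deriv (deriv g) (α * y) * α * α - g α * deriv (deriv f) y) ?_ ?_ ?_ ?_
    · intro x hx
      have h1 := (dat hg1 (mul_pos hα hx)).comp x ((hasDerivAt_id x).const_mul α)
      exact (h1.sub ((dat hf hx).const_mul (g α))).continuousAt.continuousWithinAt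
    · rw [interior_Ioi]
      intro x hx
      have h1 := (dat hg1 (mul_pos hα hx)).comp x ((hasDerivAt_id x).const_mul α)
      simp only [mul_one] at h1
      exact (h1.sub ((dat hf hx).const_mul (g α))).hasDerivWithinAt
    · rw [interior_Ioi]
      intro x hx
      have h1 := (dat hg2 (mul_pos hα hx)).comp x ((hasDerivAt_id x).const_mul α)
      simp only [mul_one] at h1
      exact ((h1.mul_const α).sub ((dat hf' hx).const_mul (g α))).hasDerivWithinAt
    · rw [interior_Ioi]
      intro x hx
      have hx : 0 < x := hx
      have h := hineq (α * x) (by positivity) α hα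
      rw [mul_div_cancel_left₀ _ hα.ne', hgf x] at h
      have hx2 : 0 < x ^ 2 := by positivity
      by_contra! hcon
      nlinarith [mul_pos hx2 hcon]
  have hJ := hconc.le_map_sum (t := Finset.univ) (fun j _ => hQ j) hQ1 (fun j _ => hY j)
  simp only [smul_eq_mul, hQY, hf1, mul_one, sub_self, mul_sub, Finset.sum_sub_distrib] at hJ
  rw [Finset.mul_sum]
  have : ∑ j, Q j * (g α * f (Y j)) = ∑ j, g α * (Q j * f (Y j)) :=
    Finset.sum_congr rfl fun _ _ => by ring
  linarith

/-- Expectations of `f` over independent positive random variables of mean `1` are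
supermultiplicative. -/
lemma mul_sum_le_sum_comp_mul (hf1 : f 1 = 1) (hf : DifferentiableOn ℝ f (Ioi 0))
    (hf' : DifferentiableOn ℝ (deriv f) (Ioi 0))
    (hg : (fun x => -(x ^ 2 * deriv (deriv f) x)) ∈ TMinus)
    {ι κ : Type*} [Fintype ι] [Fintype κ]
    (P U : ι → ℝ) (hP : ∀ i, 0 ≤ P i) (hP1 : ∑ i, P i = 1)
    (hU : ∀ i, 0 < U i) (hPU : ∑ i, P i * U i = 1)
    (Q Y : κ → ℝ) (hQ : ∀ j, 0 ≤ Q j) (hQ1 : ∑ j, Q j = 1)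
    (hY : ∀ j, 0 < Y j) (hQY : ∑ j, Q j * Y j = 1) :
    (∑ i, P i * f (U i)) * ∑ j, Q j * f (Y j) ≤ ∑ i, P i * ∑ j, Q j * f (U i * Y j) := by
  have dat : ∀ {h : ℝ → ℝ}, DifferentiableOn ℝ h (Ioi 0) → ∀ {x : ℝ}, 0 < x →
      HasDerivAt h (deriv h x) x := fun hh x hx =>
    (hh.differentiableAt (Ioi_mem_nhds hx)).hasDerivAt
  set F := ∑ j, Q j * f (Y j) with hF
  have dcomp : ∀ {h : ℝ → ℝ}, DifferentiableOn ℝ h (Ioi 0) → ∀ {x : ℝ}, 0 < x → ∀ j,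
      HasDerivAt (fun x => h (x * Y j)) (deriv h (x * Y j) * Y j) x := by
    intro h hh x hx j
    have := (dat hh (mul_pos hx (hY j))).comp x ((hasDerivAt_id x).mul_const (Y j))
    simpa only [one_mul, Function.comp_def, id] using this
  have d1 : ∀ {x : ℝ}, 0 < x → HasDerivAt (fun x => ∑ j, Q j * f (x * Y j) - f x * F)
      (∑ j, Q j * (deriv f (x * Y j) * Y j) - deriv f x * F) x := fun hx =>
    (HasDerivAt.fun_sum fun j _ => (dcomp hf hx j).const_mul (Q j)).sub ((dat hf hx).mul_const F)
  have d2 : ∀ {x : ℝ}, 0 < x →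
      HasDerivAt (fun x => ∑ j, Q j * (deriv f (x * Y j) * Y j) - deriv f x * F)
      (∑ j, Q j * (deriv (deriv f) (x * Y j) * Y j * Y j) - deriv (deriv f) x * F) x := fun hx =>
    (HasDerivAt.fun_sum fun j _ => ((dcomp hf' hx j).mul_const (Y j)).const_mul (Q j)).sub
      ((dat hf' hx).mul_const F)
  -- Times x², the second derivative is g(x) F - E g(xY), nonnegative by the preceding lemma. The
  -- function vanishes at 1, the mean of `U`, so Jensen finishes.
  have hconv : ConvexOn ℝ (Ioi (0 : ℝ)) fun x => ∑ j, Q j * f (x * Y j) - f x * F := by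
    refine convexOn_of_hasDerivWithinAt2_nonneg (convex_Ioi 0)
      (fun x hx => (d1 hx).continuousAt.continuousWithinAt)
      (fun x hx => (d1 (by simpa using hx)).hasDerivWithinAt)
      (fun x hx => (d2 (by simpa using hx)).hasDerivWithinAt) ?_
    rw [interior_Ioi]
    intro x hx
    have hx : 0 < x := hx
    have key := sum_mul_comp_le_of_mem_TMinus hf1 hf hf' (fun _ => rfl) hg Q Y hQ hQ1 hY hQY hx
    have e : ∑ j, Q j * -((x * Y j) ^ 2 * deriv (deriv f) (x * Y j)) =
        -(x ^ 2 * ∑ j, Q j * (deriv (deriv f) (x * Y j) * Y j * Y j)) := by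
      rw [Finset.mul_sum, ← Finset.sum_neg_distrib]
      exact Finset.sum_congr rfl fun _ _ => by ring
    rw [e, ← hF] at key
    have hx2 : 0 < x ^ 2 := by positivity
    by_contra! hcon
    nlinarith [mul_pos_of_neg_of_neg hcon (neg_neg_of_pos hx2)]
  have hJ := hconv.map_sum_le (t := Finset.univ) (fun i _ => hP i) hP1 (fun i _ => hU i)
  simp only [smul_eq_mul, hPU, hf1, one_mul, mul_sub, Finset.sum_sub_distrib] at hJ
  rw [← hF, sub_self] at hJ
  have : ∑ i, P i * (f (U i) * F) = (∑ i, P i * f (U i)) * F := by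
    rw [Finset.sum_mul]
    exact Finset.sum_congr rfl fun _ _ => by ring
  linarith

lemma pow_sum_le_sum_prod (hf1 : f 1 = 1) (hf : DifferentiableOn ℝ f (Ioi 0))
    (hf' : DifferentiableOn ℝ (deriv f) (Ioi 0))
    (hg : (fun x => -(x ^ 2 * deriv (deriv f) x)) ∈ TMinus)
    {κ : Type*} [Fintype κ]
    (Q Y : κ → ℝ) (hQ : ∀ j, 0 ≤ Q j) (hQ1 : ∑ j, Q j = 1)
    (hY : ∀ j, 0 < Y j) (hQY : ∑ j, Q j * Y j = 1) (hF : 0 ≤ ∑ j, Q j * f (Y j)) (n : ℕ) :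
    (∑ j, Q j * f (Y j)) ^ n ≤
      ∑ z : Fin n → κ, (∏ k, Q (z k)) * f (∏ k, Y (z k)) := by
  induction n with
  | zero => simp [hf1]
  | succ n ih =>
    have h := mul_sum_le_sum_comp_mul hf1 hf hf' hg Q Y hQ hQ1 hY hQY
      (fun z : Fin n → κ => ∏ k, Q (z k)) (fun z => ∏ k, Y (z k))
      (fun z => Finset.prod_nonneg fun _ _ => hQ _)
      (by rw [sum_prod_apply fun _ => Q]; simp [hQ1])
      (fun z => Finset.prod_pos fun _ _ => hY _)
      (by simp_rw [← Finset.prod_mul_distrib]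
          rw [sum_prod_apply fun _ j => Q j * Y j]; simp [hQY])
    rw [pow_succ']
    refine (mul_le_mul_of_nonneg_left ih hF).trans (h.trans_eq ?_)
    rw [← (Fin.consEquiv fun _ => κ).sum_comp, Fintype.sum_prod_type]
    refine Finset.sum_congr rfl fun i _ => ?_
    rw [Finset.mul_sum]
    refine Finset.sum_congr rfl fun z _ => ?_
    simp [Fin.prod_univ_succ, Fin.consEquiv, mul_assoc]

end Tensorization

lemma le_of_forall_pow_le_mul_pow {x y b : ℝ} (hy : 0 < y) (h : ∀ n : ℕ, x ^ n ≤ b * y ^ n) :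
    x ≤ y := by
  by_contra! hlt
  have h1 : 1 < x / y := (one_lt_div hy).2 hlt
  obtain ⟨n, hn⟩ := pow_unbounded_of_one_lt b h1
  rw [div_pow, lt_div_iff₀ (by positivity)] at hn
  exact absurd (h n) (not_le.2 hn)

/-- For an admissible family, `E f_s(Y) ≤ E Y ^ s` for all positive `Y` of mean `1`. -/
lemma Admissible.sum_genFun_le {a b : ℝ} {ψ : ℝ → ℝ → ℝ} (hψ : Admissible a b ψ) (ha : 0 < a)
    {s : ℝ} (hs : s ∈ Ioo (0 : ℝ) 1) {κ : Type*} [Fintype κ]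
    (Q Y : κ → ℝ) (hQ : ∀ j, 0 ≤ Q j) (hQ1 : ∑ j, Q j = 1)
    (hY : ∀ j, 0 < Y j) (hQY : ∑ j, Q j * Y j = 1) :
    0 < ∑ j, Q j * genFun ψ s (Y j) ∧
      ∑ j, Q j * genFun ψ s (Y j) ≤ ∑ j, Q j * Y j ^ s := by
  obtain ⟨hab, h0, hf, hf', hg⟩ := hψ s hs
  have hSpos : 0 < ∑ j, Q j * Y j ^ s := by
    obtain ⟨j, hj⟩ : ∃ j, Q j ≠ 0 := by
      by_contra! hcon
      simp [hcon] at hQ1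
    exact Finset.sum_pos' (fun j _ => mul_nonneg (hQ j) (Real.rpow_nonneg (hY j).le s))
      ⟨j, Finset.mem_univ j,
        mul_pos (lt_of_le_of_ne (hQ j) hj.symm) (Real.rpow_pos_of_pos (hY j) s)⟩
  have hlow : a * ∑ j, Q j * Y j ^ s ≤ ∑ j, Q j * genFun ψ s (Y j) := by
    rw [Finset.mul_sum]
    refine Finset.sum_le_sum fun j _ => ?_
    have h1 := Real.rpow_nonneg (hY j).le s
    have h2 := mul_le_mul_of_nonneg_left (hab (Real.log (Y j))).1 (mul_nonneg (hQ j) h1)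
    rw [genFun]
    linarith
  have hFpos := (mul_pos ha hSpos).trans_le hlow
  -- The factor `b` between f_s and the power is paid once for a product of n copies, whatever n is.
  refine ⟨hFpos, le_of_forall_pow_le_mul_pow (b := b) hSpos fun n => ?_⟩
  have h := pow_sum_le_sum_prod (by simp [genFun, h0]) hf hf' hg Q Y hQ hQ1 hY hQY hFpos.le n
  refine h.trans ?_
  rw [Finset.sum_pow', Finset.mul_sum]
  simp only [Fintype.piFinset_univ]
  refine Finset.sum_le_sum fun z _ => ?_
  rw [Finset.prod_mul_distrib, Real.finsetProd_rpow _ _ fun k _ => (hY _).le, genFun]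
  have h1 : 0 ≤ (∏ k, Q (z k)) * (∏ k, Y (z k)) ^ s :=
    mul_nonneg (Finset.prod_nonneg fun _ _ => hQ _)
      (Real.rpow_nonneg (Finset.prod_nonneg fun _ _ => (hY _).le) s)
  have h2 := mul_le_mul_of_nonneg_left (hab (Real.log (∏ k, Y (z k)))).2 h1
  linarith

/-! ### Chernoff coefficients, relative entropy and tilted laws -/

/-- The Chernoff coefficient `∑ w ^ (1 - s) q ^ s`. -/
def affinity {Y : Type*} [Fintype Y] (s : ℝ) (w q : Y → ℝ) : ℝ :=
  ∑ y, w y ^ (1 - s) * q y ^ s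

/-- The relative entropy `∑ p log (p / q)`. -/
def relEnt {Y : Type*} [Fintype Y] (p q : Y → ℝ) : ℝ :=
  ∑ y, p y * Real.log (p y / q y)

section RelEnt

variable {Y : Type*} [Fintype Y] {p q : Y → ℝ}

lemma relEnt_eq_sum_klFun (hq : ∀ y, 0 < q y) (hpq : ∑ y, p y = ∑ y, q y) :
    relEnt p q = ∑ y, q y * InformationTheory.klFun (p y / q y) := by
  have : ∀ y, q y * InformationTheory.klFun (p y / q y) =
      p y * Real.log (p y / q y) + (q y - p y) := by
    intro y
    have := (hq y).ne'
    rw [InformationTheory.klFun_apply]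
    field_simp
    ring
  simp_rw [this, Finset.sum_add_distrib, Finset.sum_sub_distrib, hpq, sub_self, add_zero, relEnt]

lemma relEnt_nonneg (hp : ∀ y, 0 ≤ p y) (hq : ∀ y, 0 < q y) (hpq : ∑ y, p y = ∑ y, q y) :
    0 ≤ relEnt p q := by
  rw [relEnt_eq_sum_klFun hq hpq]
  exact Finset.sum_nonneg fun y _ => mul_nonneg (hq y).le
    (InformationTheory.klFun_nonneg (div_nonneg (hp y) (hq y).le))

lemma eq_of_relEnt_nonpos (hp : ∀ y, 0 ≤ p y) (hq : ∀ y, 0 < q y) (hpq : ∑ y, p y = ∑ y, q y)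
    (h : relEnt p q ≤ 0) (y : Y) : p y = q y := by
  have h0 := le_antisymm h (relEnt_nonneg hp hq hpq)
  have hnn : ∀ y, 0 ≤ q y * InformationTheory.klFun (p y / q y) := fun y =>
    mul_nonneg (hq y).le (InformationTheory.klFun_nonneg (div_nonneg (hp y) (hq y).le))
  rw [relEnt_eq_sum_klFun hq hpq, Finset.sum_eq_zero_iff_of_nonneg fun y _ => hnn y] at h0
  have h1 := (mul_eq_zero.1 (h0 y (Finset.mem_univ y))).resolve_left (hq y).ne'
  rw [InformationTheory.klFun_eq_zero_iff (div_nonneg (hp y) (hq y).le)] at h1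
  exact (div_eq_one_iff_eq (hq y).ne').1 h1

end RelEnt

section Affinity

variable {Y : Type*} [Fintype Y] {s : ℝ} {w q V : Y → ℝ}

lemma affinity_le_one (hs0 : 0 ≤ s) (hs1 : s ≤ 1) (hw : w ∈ stdSimplex ℝ Y)
    (hq : q ∈ stdSimplex ℝ Y) : affinity s w q ≤ 1 := by
  calc affinity s w q ≤ ∑ y, ((1 - s) * w y + s * q y) := Finset.sum_le_sum fun y _ =>
        Real.geom_mean_le_arith_mean2_weighted (by linarith) hs0 (hw.1 y) (hq.1 y) (by ring)
    _ = 1 := by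
        rw [Finset.sum_add_distrib, ← Finset.mul_sum, ← Finset.mul_sum, hw.2, hq.2]; ring

lemma le_one_of_mem_stdSimplex (hq : q ∈ stdSimplex ℝ Y) (y : Y) : q y ≤ 1 :=
  hq.2 ▸ Finset.single_le_sum (fun y _ => hq.1 y) (Finset.mem_univ y)

lemma rpow_le_affinity {δ : ℝ} (hδ : 0 < δ) (hs1 : s ≤ 1)
    (hw : ∀ y, δ ≤ w y) (hq : q ∈ stdSimplex ℝ Y) : δ ^ (1 - s) ≤ affinity s w q := by
  calc δ ^ (1 - s) = ∑ y, δ ^ (1 - s) * q y := by rw [← Finset.mul_sum, hq.2, mul_one]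
    _ ≤ affinity s w q := Finset.sum_le_sum fun y _ =>
        mul_le_mul (Real.rpow_le_rpow hδ.le (hw y) (by linarith))
          (Real.self_le_rpow_of_le_one (hq.1 y) (le_one_of_mem_stdSimplex hq y) hs1) (hq.1 y)
          (Real.rpow_nonneg (hδ.le.trans (hw y)) _)

lemma affinity_pos [Nonempty Y] (hw : ∀ y, 0 < w y) (hq : ∀ y, 0 < q y) : 0 < affinity s w q :=
  Finset.sum_pos (fun y _ => mul_pos (Real.rpow_pos_of_pos (hw y) _)
    (Real.rpow_pos_of_pos (hq y) _)) Finset.univ_nonempty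

lemma concaveOn_affinity (hs0 : 0 ≤ s) (hs1 : s ≤ 1) (hw : ∀ y, 0 ≤ w y) :
    ConcaveOn ℝ (stdSimplex ℝ Y) (affinity s w) := by
  refine ⟨convex_stdSimplex ℝ Y, fun q hq q' hq' a b ha hb hab => ?_⟩
  simp only [affinity, smul_eq_mul, Finset.mul_sum]
  rw [← Finset.sum_add_distrib]
  refine Finset.sum_le_sum fun y _ => ?_
  have h := (Real.concaveOn_rpow hs0 hs1).2 (hq.1 y) (hq'.1 y) ha hb hab
  simp only [smul_eq_mul] at h
  have h2 := mul_le_mul_of_nonneg_left h (Real.rpow_nonneg (hw y) (1 - s))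
  simp only [Pi.add_apply, Pi.smul_apply, smul_eq_mul]
  linarith

/-- Variational characterization of the Chernoff coefficient, the inequality. -/
lemma neg_log_affinity_le (hw : ∀ y, 0 < w y) (hq : ∀ y, 0 < q y)
    (hV : ∀ y, 0 < V y) (hV1 : ∑ y, V y = 1) :
    -Real.log (affinity s w q) ≤ (1 - s) * relEnt V w + s * relEnt V q := by
  have hJ := strictConcaveOn_log_Ioi.concaveOn.le_map_sum (t := Finset.univ)
    (w := V) (p := fun y => w y ^ (1 - s) * q y ^ s / V y) (fun y _ => (hV y).le) hV1
    (fun y _ => div_pos (mul_pos (Real.rpow_pos_of_pos (hw y) _)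
      (Real.rpow_pos_of_pos (hq y) _)) (hV y))
  simp only [smul_eq_mul] at hJ
  have e1 : ∑ y, V y * (w y ^ (1 - s) * q y ^ s / V y) = affinity s w q :=
    Finset.sum_congr rfl fun y _ => by field_simp [(hV y).ne']
  rw [e1] at hJ
  have e2 : ∑ y, V y * Real.log (w y ^ (1 - s) * q y ^ s / V y) =
      -((1 - s) * relEnt V w + s * relEnt V q) := by
    rw [relEnt, relEnt, Finset.mul_sum, Finset.mul_sum, ← Finset.sum_add_distrib,
      ← Finset.sum_neg_distrib]
    refine Finset.sum_congr rfl fun y _ => ?_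
    rw [Real.log_div (by have := Real.rpow_pos_of_pos (hw y) (1 - s)
                         have := Real.rpow_pos_of_pos (hq y) s
                         positivity) (hV y).ne',
      Real.log_mul (Real.rpow_pos_of_pos (hw y) _).ne' (Real.rpow_pos_of_pos (hq y) _).ne',
      Real.log_rpow (hw y), Real.log_rpow (hq y), Real.log_div (hV y).ne' (hw y).ne',
      Real.log_div (hV y).ne' (hq y).ne']
    ring
  linarith

/-- The tilted distribution `w ^ (1 - s) q ^ s / ∑ w ^ (1 - s) q ^ s`. -/
def tilt (s : ℝ) (w q : Y → ℝ) (y : Y) : ℝ := w y ^ (1 - s) * q y ^ s / affinity s w q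

lemma tilt_pos [Nonempty Y] (hw : ∀ y, 0 < w y) (hq : ∀ y, 0 < q y) (y : Y) :
    0 < tilt s w q y :=
  div_pos (mul_pos (Real.rpow_pos_of_pos (hw y) _) (Real.rpow_pos_of_pos (hq y) _))
    (affinity_pos hw hq)

lemma sum_tilt [Nonempty Y] (hw : ∀ y, 0 < w y) (hq : ∀ y, 0 < q y) :
    ∑ y, tilt s w q y = 1 := by
  simp only [tilt]
  rw [← Finset.sum_div]
  exact div_self (affinity_pos hw hq).ne'

lemma relEnt_tilt [Nonempty Y] (hw : ∀ y, 0 < w y) (hq : ∀ y, 0 < q y) :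
    (1 - s) * relEnt (tilt s w q) w + s * relEnt (tilt s w q) q =
      -Real.log (affinity s w q) := by
  rw [relEnt, relEnt, Finset.mul_sum, Finset.mul_sum, ← Finset.sum_add_distrib]
  have : ∀ y, (1 - s) * (tilt s w q y * Real.log (tilt s w q y / w y)) +
      s * (tilt s w q y * Real.log (tilt s w q y / q y)) =
      tilt s w q y * -Real.log (affinity s w q) := by
    intro y
    have hl : Real.log (tilt s w q y) =
        (1 - s) * Real.log (w y) + s * Real.log (q y) - Real.log (affinity s w q) := by
      rw [tilt, Real.log_div (by have := Real.rpow_pos_of_pos (hw y) (1 - s)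
                                 have := Real.rpow_pos_of_pos (hq y) s
                                 positivity) (affinity_pos hw hq).ne',
        Real.log_mul (Real.rpow_pos_of_pos (hw y) _).ne' (Real.rpow_pos_of_pos (hq y) _).ne',
        Real.log_rpow (hw y), Real.log_rpow (hq y)]
    rw [Real.log_div (tilt_pos hw hq y).ne' (hw y).ne',
      Real.log_div (tilt_pos hw hq y).ne' (hq y).ne', hl]
    ring
  simp_rw [this]
  rw [← Finset.sum_mul, sum_tilt hw hq, one_mul]

end Affinity

/-! ### Minimax output distribution and its lower bound -/

section Saddle

variable {X Y : Type*} [Fintype X] [Fintype Y] {W : X → Y → ℝ} {s δ : ℝ}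

/-- Moving mass ε to an empty letter raises every Chernoff coefficient by at least δ ε^s and costs
at most a fraction ε of it. -/
lemma pos_of_minimizes_affinity (hs : s ∈ Ioo (0 : ℝ) 1) (hδ : 0 < δ) (hδ1 : δ ≤ 1)
    (hW : ∀ x, W x ∈ stdSimplex ℝ Y) (hWδ : ∀ x y, δ ≤ W x y)
    {p : X → ℝ} (hp : p ∈ stdSimplex ℝ X) {q : Y → ℝ} (hq : q ∈ stdSimplex ℝ Y)
    (hmin : ∀ q' ∈ stdSimplex ℝ Y, ∑ x, p x * -Real.log (affinity s (W x) q) ≤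
      ∑ x, p x * -Real.log (affinity s (W x) q')) (y : Y) : 0 < q y := by
  classical
  by_contra! hcon
  have hy : q y = 0 := le_antisymm hcon (hq.1 y)
  have h1s : 0 < 1 - s := by linarith [hs.2]
  -- Chosen so that ε^(1-s) = δ/2, which makes the gain δ ε^s exceed the loss ε.
  set ε := (δ / 2) ^ (1 / (1 - s)) with hε
  have hε0 : 0 < ε := by positivity
  have hε1 : ε ≤ 1 := Real.rpow_le_one (by positivity) (by linarith) (by positivity)
  have hεs : ε ^ (1 - s) = δ / 2 := by
    rw [hε, ← Real.rpow_mul (by positivity), one_div_mul_cancel h1s.ne', Real.rpow_one]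
  have hεδ : ε < δ * ε ^ s := by
    have hsp : 0 < ε ^ s := by positivity
    calc ε = ε ^ (1 - s) * ε ^ s := by rw [← Real.rpow_add hε0]; simp
      _ = δ / 2 * ε ^ s := by rw [hεs]
      _ < δ * ε ^ s := by nlinarith
  set q' : Y → ℝ := (1 - ε) • q + ε • Pi.single y 1 with hq'
  have hq'S : q' ∈ stdSimplex ℝ Y :=
    convex_stdSimplex ℝ Y hq (single_mem_stdSimplex ℝ y) (by linarith) hε0.le (by ring)
  have hlt : ∀ x, affinity s (W x) q < affinity s (W x) q' := by
    intro x
    have hA1 : affinity s (W x) q ≤ 1 := affinity_le_one hs.1.le hs.2.le (hW x) hq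
    have hterm : ∀ z, (1 - ε) * (W x z ^ (1 - s) * q z ^ s) +
        (if z = y then δ * ε ^ s else 0) ≤ W x z ^ (1 - s) * q' z ^ s := by
      intro z
      by_cases hz : z = y
      · subst hz
        have h1 : δ ≤ W x z ^ (1 - s) :=
          (hWδ x z).trans (Real.self_le_rpow_of_le_one ((hW x).1 z)
            (le_one_of_mem_stdSimplex (hW x) z) (by linarith [hs.1]))
        simp only [hq', hy, Pi.add_apply, Pi.smul_apply, smul_eq_mul, Pi.single_eq_same, mul_zero,
          zero_add, mul_one, if_true, Real.zero_rpow hs.1.ne']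
        exact mul_le_mul_of_nonneg_right h1 (by positivity)
      · have h1 : 1 - ε ≤ (1 - ε) ^ s :=
          Real.self_le_rpow_of_le_one (by linarith) (by linarith) hs.2.le
        simp only [hq', Pi.add_apply, Pi.smul_apply, smul_eq_mul, Pi.single_eq_of_ne hz, mul_zero,
          add_zero, hz, if_false]
        rw [Real.mul_rpow (by linarith) (hq.1 z)]
        have h2 : 0 ≤ W x z ^ (1 - s) * q z ^ s :=
          mul_nonneg (Real.rpow_nonneg ((hW x).1 z) _) (Real.rpow_nonneg (hq.1 z) _)
        nlinarith
    have hsum := Finset.sum_le_sum fun z (_ : z ∈ Finset.univ) => hterm z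
    rw [Finset.sum_add_distrib, ← Finset.mul_sum, Finset.sum_ite_eq' Finset.univ y,
      if_pos (Finset.mem_univ y)] at hsum
    change (1 - ε) * affinity s (W x) q + δ * ε ^ s ≤ affinity s (W x) q' at hsum
    nlinarith
  have hApos : ∀ x, 0 < affinity s (W x) q := fun x =>
    (by positivity : 0 < δ ^ (1 - s)).trans_le
      (rpow_le_affinity hδ hs.2.le (hWδ x) hq)
  obtain ⟨x, hx⟩ : ∃ x, p x ≠ 0 := by
    by_contra! h
    simpa [h] using hp.2
  refine (hmin q' hq'S).not_gt (Finset.sum_lt_sum (fun x _ => ?_) ⟨x, Finset.mem_univ x, ?_⟩)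
  · exact mul_le_mul_of_nonneg_left (neg_le_neg (Real.log_le_log (hApos x) (hlt x).le)) (hp.1 x)
  · exact mul_lt_mul_of_pos_left (neg_lt_neg (Real.log_lt_log (hApos x) (hlt x)))
      (lt_of_le_of_ne (hp.1 x) hx.symm)

/-- A minimizer equals the `p`-average q' of its own tilts: by the variational formula, passing to
q' lowers the objective by at least s D(q'‖q). Each tilt is at least δ^(1-s) q(y)^s because Chernoff
coefficients are at most 1, so q(y) ≥ δ^(1-s) q(y)^s. -/
lemma le_of_minimizes_affinity (hs : s ∈ Ioo (0 : ℝ) 1) (hδ : 0 < δ) (hδ1 : δ ≤ 1)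
    (hW : ∀ x, W x ∈ stdSimplex ℝ Y) (hWδ : ∀ x y, δ ≤ W x y)
    {p : X → ℝ} (hp : p ∈ stdSimplex ℝ X) {q : Y → ℝ} (hq : q ∈ stdSimplex ℝ Y)
    (hmin : ∀ q' ∈ stdSimplex ℝ Y, ∑ x, p x * -Real.log (affinity s (W x) q) ≤
      ∑ x, p x * -Real.log (affinity s (W x) q')) (y : Y) : δ ≤ q y := by
  have hne : Nonempty Y := ⟨y⟩
  have hq0 := pos_of_minimizes_affinity hs hδ hδ1 hW hWδ hp hq hmin
  have hW0 : ∀ x y, 0 < W x y := fun x y => hδ.trans_le (hWδ x y)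
  set V : X → Y → ℝ := fun x => tilt s (W x) q with hV
  have hV0 : ∀ x y, 0 < V x y := fun x y => tilt_pos (hW0 x) hq0 y
  have hV1 : ∀ x, ∑ y, V x y = 1 := fun x => sum_tilt (hW0 x) hq0
  set q' : Y → ℝ := fun y => ∑ x, p x * V x y with hq'
  have hq'S : q' ∈ stdSimplex ℝ Y := by
    refine ⟨fun y => Finset.sum_nonneg fun x _ => mul_nonneg (hp.1 x) (hV0 x y).le, ?_⟩
    simp only [hq']
    rw [Finset.sum_comm]
    simp_rw [← Finset.mul_sum, hV1, mul_one, hp.2]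
  have hq'0 : ∀ y, 0 < q' y := by
    intro y
    obtain ⟨x, hx⟩ : ∃ x, p x ≠ 0 := by
      by_contra! h
      simpa [h] using hp.2
    exact Finset.sum_pos' (fun x _ => mul_nonneg (hp.1 x) (hV0 x y).le)
      ⟨x, Finset.mem_univ x, mul_pos (lt_of_le_of_ne (hp.1 x) hx.symm) (hV0 x y)⟩
  have h1 : ∑ x, p x * ((1 - s) * relEnt (V x) (W x) + s * relEnt (V x) q) ≤
      ∑ x, p x * ((1 - s) * relEnt (V x) (W x) + s * relEnt (V x) q') := by
    calc _ = ∑ x, p x * -Real.log (affinity s (W x) q) :=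
          Finset.sum_congr rfl fun x _ => by rw [hV, relEnt_tilt (hW0 x) hq0]
      _ ≤ _ := hmin q' hq'S
      _ ≤ _ := Finset.sum_le_sum fun x _ => mul_le_mul_of_nonneg_left
          (neg_log_affinity_le (hW0 x) hq'0 (hV0 x) (hV1 x)) (hp.1 x)
  have h2 : ∑ x, p x * (relEnt (V x) q - relEnt (V x) q') = relEnt q' q := by
    simp only [relEnt, ← Finset.sum_sub_distrib, Finset.mul_sum, hq', Finset.sum_mul]
    rw [Finset.sum_comm]
    refine Finset.sum_congr rfl fun y _ => Finset.sum_congr rfl fun x _ => ?_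
    rw [Real.log_div (hV0 x y).ne' (hq0 y).ne', Real.log_div (hV0 x y).ne' (hq'0 y).ne',
      Real.log_div (hq'0 y).ne' (hq0 y).ne']
    ring
  have h3 : relEnt q' q ≤ 0 := by
    have e : ∑ x, p x * ((1 - s) * relEnt (V x) (W x) + s * relEnt (V x) q) -
        ∑ x, p x * ((1 - s) * relEnt (V x) (W x) + s * relEnt (V x) q') = s * relEnt q' q := by
      rw [← h2, ← Finset.sum_sub_distrib, Finset.mul_sum]
      exact Finset.sum_congr rfl fun x _ => by ring
    have hs0 := hs.1
    by_contra! h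
    nlinarith [mul_pos hs0 h]
  have h4 : q' y = q y := eq_of_relEnt_nonpos hq'S.1 hq0 (hq'S.2.trans hq.2.symm) h3 y
  have h5 : δ ^ (1 - s) * q y ^ s ≤ q y := by
    rw [← h4]
    calc δ ^ (1 - s) * q' y ^ s = ∑ x, p x * (δ ^ (1 - s) * q y ^ s) := by
          rw [← Finset.sum_mul, hp.2, one_mul, h4]
      _ ≤ q' y := Finset.sum_le_sum fun x _ => mul_le_mul_of_nonneg_left ?_ (hp.1 x)
    simp only [hV, tilt]
    rw [le_div_iff₀ (affinity_pos (hW0 x) hq0)]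
    have h6 := affinity_le_one hs.1.le hs.2.le (hW x) hq
    have h7 : δ ^ (1 - s) ≤ W x y ^ (1 - s) :=
      Real.rpow_le_rpow hδ.le (hWδ x y) (by linarith [hs.2])
    have h8 : 0 < q y ^ s := Real.rpow_pos_of_pos (hq0 y) s
    calc δ ^ (1 - s) * q y ^ s * affinity s (W x) q ≤ δ ^ (1 - s) * q y ^ s * 1 :=
          mul_le_mul_of_nonneg_left h6 (by positivity)
      _ ≤ W x y ^ (1 - s) * q y ^ s := by rw [mul_one]; exact mul_le_mul_of_nonneg_right h7 h8.le
  have h6 : δ ^ (1 - s) ≤ q y ^ (1 - s) := by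
    rw [Real.rpow_sub (hq0 y), Real.rpow_one, le_div_iff₀ (Real.rpow_pos_of_pos (hq0 y) s)]
    exact h5
  exact (Real.rpow_le_rpow_iff hδ.le (hq0 y).le (by linarith [hs.2])).1 h6

/-- Sion's theorem for an objective convex in q and linear in p. Testing the saddle point against
the vertices of the input simplex gives the bound letter by letter. -/
lemma exists_saddle [Nonempty X] (hs : s ∈ Ioo (0 : ℝ) 1) (hδ : 0 < δ) (hδ1 : δ ≤ 1)
    (hW : ∀ x, W x ∈ stdSimplex ℝ Y) (hWδ : ∀ x y, δ ≤ W x y) :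
    ∃ v : ℝ, ∃ p ∈ stdSimplex ℝ X, ∃ q ∈ stdSimplex ℝ Y, (∀ y, δ ≤ q y) ∧
      (∀ x, -Real.log (affinity s (W x) q) ≤ v) ∧
      ∀ q' ∈ stdSimplex ℝ Y, v ≤ ∑ x, p x * -Real.log (affinity s (W x) q') := by
  classical
  have hApos : ∀ x, ∀ q ∈ stdSimplex ℝ Y, 0 < affinity s (W x) q := fun x q hq =>
    (by positivity : 0 < δ ^ (1 - s)).trans_le
      (rpow_le_affinity hδ hs.2.le (hWδ x) hq)
  have hcont : ∀ x, Continuous (affinity s (W x)) := fun x => by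
    unfold affinity
    exact continuous_finsetSum _ fun y _ => continuous_const.mul
      ((continuous_apply y).rpow_const fun _ => Or.inr hs.1.le)
  have hlog : ∀ x, ConvexOn ℝ (stdSimplex ℝ Y) fun q => -Real.log (affinity s (W x) q) := by
    intro x
    refine ⟨convex_stdSimplex ℝ Y, fun q hq q' hq' a b ha hb hab => ?_⟩
    have h1 := (concaveOn_affinity hs.1.le hs.2.le (hW x).1).2 hq hq' ha hb hab
    have h2 := strictConcaveOn_log_Ioi.concaveOn.2 (hApos x q hq) (hApos x q' hq') ha hb hab
    have h3 := Real.log_le_log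
      ((convex_Ioi (0 : ℝ)) (hApos x q hq) (hApos x q' hq') ha hb hab) h1
    simp only [smul_eq_mul] at h1 h2 h3 ⊢
    linarith
  have hneY : (stdSimplex ℝ Y).Nonempty := ⟨_, hW (Classical.arbitrary X)⟩
  have hneX : (stdSimplex ℝ X).Nonempty := ⟨_, single_mem_stdSimplex ℝ (Classical.arbitrary X)⟩
  have h1 : ∀ p ∈ stdSimplex ℝ X, LowerSemicontinuousOn
      (fun q => ∑ x, p x * -Real.log (affinity s (W x) q)) (stdSimplex ℝ Y) := fun p _ =>
    ContinuousOn.lowerSemicontinuousOn (continuousOn_finsetSum _ fun x _ => continuousOn_const.mul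
      (((hcont x).continuousOn.log fun q hq => (hApos x q hq).ne').neg))
  have h2 : ∀ p ∈ stdSimplex ℝ X, QuasiconvexOn ℝ (stdSimplex ℝ Y)
      (fun q => ∑ x, p x * -Real.log (affinity s (W x) q)) := by
    intro p hp
    refine ConvexOn.quasiconvexOn ⟨convex_stdSimplex ℝ Y, fun q hq q' hq' a b ha hb hab => ?_⟩
    simp only [smul_eq_mul, Finset.mul_sum]
    rw [← Finset.sum_add_distrib]
    refine Finset.sum_le_sum fun x _ => ?_
    have h := mul_le_mul_of_nonneg_left ((hlog x).2 hq hq' ha hb hab) (hp.1 x)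
    simp only [smul_eq_mul] at h
    linarith
  have h3 : ∀ q ∈ stdSimplex ℝ Y, UpperSemicontinuousOn
      (fun p : X → ℝ => ∑ x, p x * -Real.log (affinity s (W x) q)) (stdSimplex ℝ X) := fun q _ =>
    ContinuousOn.upperSemicontinuousOn (Continuous.continuousOn
      (continuous_finsetSum _ fun x _ => (continuous_apply x).mul continuous_const))
  have h4 : ∀ q ∈ stdSimplex ℝ Y, QuasiconcaveOn ℝ (stdSimplex ℝ X)
      (fun p : X → ℝ => ∑ x, p x * -Real.log (affinity s (W x) q)) := by
    intro q hq
    refine ConcaveOn.quasiconcaveOn ⟨convex_stdSimplex ℝ X, fun p _ p' _ a b _ _ _ => ?_⟩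
    simp only [smul_eq_mul, Finset.mul_sum]
    rw [← Finset.sum_add_distrib]
    refine Finset.sum_le_sum fun x _ => le_of_eq ?_
    simp only [Pi.add_apply, Pi.smul_apply, smul_eq_mul]
    ring
  obtain ⟨q, hq, p, hp, hsad⟩ := Sion.exists_isSaddlePointOn' hneY (isCompact_stdSimplex ℝ Y)
    h1 h2 (convex_stdSimplex ℝ X) (isCompact_stdSimplex ℝ X) h3 h4 (convex_stdSimplex ℝ Y) hneX
  refine ⟨_, p, hp, q, hq, ?_, fun x => ?_, fun q' hq' => hsad q' hq' p hp⟩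
  · exact le_of_minimizes_affinity hs hδ hδ1 hW hWδ hp hq fun q' hq' => hsad q' hq' p hp
  · simpa [Pi.single_apply] using hsad q hq _ (single_mem_stdSimplex ℝ x)

end Saddle

/-! ### Comparison of the (G, f)-exponent with the classical one -/

section Exponent

variable {X Y : Type*} [Fintype X] [Fintype Y] {W : X → Y → ℝ} {a b : ℝ} {ψ : ℝ → ℝ → ℝ}

lemma fDiv_tildeFun {f : ℝ → ℝ} {w q : Y → ℝ} (hw : ∀ y, 0 < w y) (hw1 : ∑ y, w y = 1)
    (hq : ∀ y, 0 < q y) : fDiv (tildeFun f) w q = 1 - ∑ y, w y * f (q y / w y) := by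
  rw [← hw1, fDiv, ← Finset.sum_sub_distrib]
  refine Finset.sum_congr rfl fun y _ => ?_
  have h1 := (hw y).ne'
  have h2 := (hq y).ne'
  rw [tildeFun, one_div_div]
  field_simp

/-- With this G the summand is -log E_W f_s(q/W), and E_W f_s(q/W) ≤ E_W (q/W)^s, the Chernoff
coefficient. Absolute continuity forces q > 0 since `W` is positive. -/
lemma coe_le_gfInfo (hψ : Admissible a b ψ) (ha : 0 < a) {s : ℝ} (hs : s ∈ Ioo (0 : ℝ) 1)
    (hW : ∀ x, W x ∈ stdSimplex ℝ Y) (hWpos : ∀ x y, 0 < W x y)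
    {p : X → ℝ} (hp : p ∈ stdSimplex ℝ X) {v : ℝ}
    (hv : ∀ q ∈ stdSimplex ℝ Y, v ≤ ∑ x, p x * -Real.log (affinity s (W x) q)) :
    (v : EReal) ≤ gfInfo negLogOneSub (tildeFun (genFun ψ s)) p W := by
  refine le_iInf₂ fun q hq => EReal.coe_le_coe_iff.2 ?_
  obtain ⟨hq, hac⟩ := hq
  obtain ⟨x₀, hx₀⟩ : ∃ x, p x ≠ 0 := by
    by_contra! h
    simpa [h] using hp.2
  have hq0 : ∀ y, 0 < q y := fun y =>
    lt_of_le_of_ne (hq.1 y) fun h => (hWpos x₀ y).ne' (hac x₀ hx₀ y h.symm)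
  refine (hv q hq).trans (Finset.sum_le_sum fun x _ => mul_le_mul_of_nonneg_left ?_ (hp.1 x))
  rw [negLogOneSub, fDiv_tildeFun (hWpos x) (hW x).2 hq0, sub_sub_cancel]
  obtain ⟨h1, h2⟩ := hψ.sum_genFun_le ha hs (W x) (fun y => q y / W x y) (hW x).1 (hW x).2
    (fun y => div_pos (hq0 y) (hWpos x y))
    (by rw [← hq.2]; exact Finset.sum_congr rfl fun y _ => mul_div_cancel₀ _ (hWpos x y).ne')
  refine neg_le_neg (Real.log_le_log h1 (h2.trans_eq ?_))
  refine Finset.sum_congr rfl fun y _ => ?_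
  rw [Real.div_rpow (hq0 y).le (hWpos x y).le, Real.rpow_sub (hWpos x y), Real.rpow_one]
  ring

lemma coe_le_spExponent (hψ : Admissible a b ψ) (ha : 0 < a) {s : ℝ} (hs : s ∈ Ioo (0 : ℝ) 1)
    (hW : ∀ x, W x ∈ stdSimplex ℝ Y) (hWpos : ∀ x y, 0 < W x y)
    {p : X → ℝ} (hp : p ∈ stdSimplex ℝ X) {v : ℝ}
    (hv : ∀ q ∈ stdSimplex ℝ Y, v ≤ ∑ x, p x * -Real.log (affinity s (W x) q)) (R : ℝ) :
    ((v / (1 - s) - s / (1 - s) * R : ℝ) : EReal) ≤ spExponent ψ W R := by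
  refine le_trans ?_ (le_iSup₂_of_le p hp (le_iSup₂_of_le s hs le_rfl))
  rw [EReal.coe_sub, EReal.coe_div]
  exact EReal.sub_le_sub (EReal.div_le_div_right_of_nonneg
    (by exact_mod_cast (by linarith [hs.2] : (0 : ℝ) ≤ 1 - s))
    (coe_le_gfInfo hψ ha hs hW hWpos hp hv)) le_rfl

end Exponent

/-! ### Concentration and change of measure for product laws -/

section ChangeOfMeasure

variable {Y : Type*} [Fintype Y] {n : ℕ}

/-- Uses exp u ≤ 1 + u + u² for |u| ≤ 1. The scale 2αt gives |u| ≤ 1/t, and the linear term has mean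
zero. -/
lemma sum_mul_exp_sub_mean_le {V a : Y → ℝ} (hV : ∀ y, 0 ≤ V y) (hV1 : ∑ y, V y = 1)
    {α : ℝ} (hα : 0 < α) (ha : ∀ y, |a y| ≤ α) {t : ℝ} (ht : 1 ≤ t) :
    ∑ y, V y * Real.exp ((a y - ∑ z, V z * a z) / (2 * α * t)) ≤ 1 + 1 / t ^ 2 := by
  set m := ∑ z, V z * a z with hm
  have hmα : |m| ≤ α := by
    calc |m| ≤ ∑ z, |V z * a z| := Finset.abs_sum_le_sum_abs _ _
      _ ≤ ∑ z, V z * α := Finset.sum_le_sum fun z _ => by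
          rw [abs_mul, abs_of_nonneg (hV z)]; exact mul_le_mul_of_nonneg_left (ha z) (hV z)
      _ = α := by rw [← Finset.sum_mul, hV1, one_mul]
  have ht0 : 0 < t := by linarith
  have hu : ∀ y, |(a y - m) / (2 * α * t)| ≤ 1 / t := by
    intro y
    rw [abs_div, abs_of_pos (by positivity : 0 < 2 * α * t), div_le_div_iff₀ (by positivity) ht0]
    have := (abs_sub (a y) m).trans (add_le_add (ha y) hmα)
    nlinarith
  have hexp : ∀ y, Real.exp ((a y - m) / (2 * α * t)) ≤
      1 + 1 / t ^ 2 + (a y - m) / (2 * α * t) := by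
    intro y
    have h1 : 1 / t ≤ 1 := by rw [div_le_one ht0]; exact ht
    have h2 := (abs_le.1 (Real.abs_exp_sub_one_sub_id_le ((hu y).trans h1))).2
    have h3 : ((a y - m) / (2 * α * t)) ^ 2 ≤ 1 / t ^ 2 := by
      rw [← sq_abs, ← one_div_pow]
      exact pow_le_pow_left₀ (abs_nonneg _) (hu y) 2
    linarith
  calc _ ≤ ∑ y, V y * (1 + 1 / t ^ 2 + (a y - m) / (2 * α * t)) :=
        Finset.sum_le_sum fun y _ => mul_le_mul_of_nonneg_left (hexp y) (hV y)
    _ = (1 + 1 / t ^ 2) * ∑ y, V y + (∑ y, V y * a y - m * ∑ y, V y) / (2 * α * t) := by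
        rw [Finset.mul_sum, Finset.mul_sum, ← Finset.sum_sub_distrib, Finset.sum_div,
          ← Finset.sum_add_distrib]
        exact Finset.sum_congr rfl fun y _ => by ring
    _ = 1 + 1 / t ^ 2 := by rw [hV1, ← hm]; ring

/-- Chernoff bound at scale t = √n: the exponential moment is at most (1 + 1/n)^n ≤ e, the exponent
exceeds 4 on the event, and e⁻³ ≤ 1/8. -/
lemma sum_prod_large_deviation_le (hn : 0 < n) {V a : Fin n → Y → ℝ} (hV : ∀ k y, 0 ≤ V k y)
    (hV1 : ∀ k, ∑ y, V k y = 1) {α : ℝ} (hα : 0 < α) (ha : ∀ k y, |a k y| ≤ α)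
    {r : ℝ} (hr : r = ∑ k, ∑ y, V k y * a k y + 8 * α * Real.sqrt n) :
    (∑ z : Fin n → Y, if r < ∑ k, a k (z k) then ∏ k, V k (z k) else 0) ≤ 1 / 8 := by
  have hn1 : (1 : ℝ) ≤ n := by exact_mod_cast hn
  set t := Real.sqrt n with ht
  have ht1 : 1 ≤ t := Real.one_le_sqrt.2 hn1
  have ht0 : 0 < t := by linarith
  have ht2 : t ^ 2 = n := Real.sq_sqrt (by linarith)
  set e : Fin n → Y → ℝ := fun k y =>
    V k y * Real.exp ((a k y - ∑ y, V k y * a k y) / (2 * α * t)) with he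
  have hterm : ∀ z : Fin n → Y,
      (if r < ∑ k, a k (z k) then ∏ k, V k (z k) else 0) ≤
      (∏ k, e k (z k)) * Real.exp (-4) := by
    intro z
    have h1 : ∏ k, e k (z k) = (∏ k, V k (z k)) *
        Real.exp ((∑ k, a k (z k) - ∑ k, ∑ y, V k y * a k y) / (2 * α * t)) := by
      rw [he, Finset.prod_mul_distrib, ← Real.exp_sum, ← Finset.sum_sub_distrib, Finset.sum_div]
    have h2 : 0 ≤ ∏ k, V k (z k) := Finset.prod_nonneg fun k _ => hV k _
    rw [h1, mul_assoc, ← Real.exp_add]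
    split_ifs with h
    · refine le_mul_of_one_le_right h2 (Real.one_le_exp ?_)
      have : 4 ≤ (∑ k, a k (z k) - ∑ k, ∑ y, V k y * a k y) / (2 * α * t) := by
        rw [le_div_iff₀ (by positivity)]
        linarith
      linarith
    · exact mul_nonneg h2 (Real.exp_pos _).le
  refine (Finset.sum_le_sum fun z _ => hterm z).trans ?_
  rw [← Finset.sum_mul, sum_prod_apply]
  have h3 : ∏ k, ∑ y, e k y ≤ Real.exp 1 := by
    calc ∏ k, ∑ y, e k y ≤ ∏ _k : Fin n, (1 + 1 / t ^ 2) :=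
          Finset.prod_le_prod (fun k _ => Finset.sum_nonneg fun y _ =>
            mul_nonneg (hV k y) (Real.exp_pos _).le)
            fun k _ => sum_mul_exp_sub_mean_le (hV k) (hV1 k) hα (ha k) ht1
      _ ≤ ∏ _k : Fin n, Real.exp (1 / n) := Finset.prod_le_prod (fun _ _ => by positivity)
          fun _ _ => by rw [ht2, add_comm]; exact Real.add_one_le_exp _
      _ = Real.exp 1 := by
          rw [← Real.exp_sum]
          simp [(by linarith : (n : ℝ) ≠ 0)]
  calc _ ≤ Real.exp 1 * Real.exp (-4) := mul_le_mul_of_nonneg_right h3 (Real.exp_pos _).le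
    _ = (Real.exp 3)⁻¹ := by rw [← Real.exp_add, ← Real.exp_neg]; norm_num
    _ ≤ 1 / 8 := by
        rw [one_div]
        refine inv_anti₀ (by norm_num) ?_
        have := Real.quadratic_le_exp_of_nonneg (by norm_num : (0 : ℝ) ≤ 3)
        linarith

/-- A product event that is unlikely under `q` has a complement that is not too unlikely
under `W`, with exponents given by relative entropies to an auxiliary product distribution `V`. -/
lemma exp_neg_relEnt_le_sum_compl (hn : 0 < n) {V W : Fin n → Y → ℝ} {q : Y → ℝ}
    (hV : ∀ k y, 0 < V k y) (hV1 : ∀ k, ∑ y, V k y = 1) (hW : ∀ k y, 0 < W k y)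
    (hq : ∀ y, 0 < q y) {α β : ℝ} (hα : 0 < α) (hβ : 0 < β)
    (hVq : ∀ k y, |Real.log (V k y / q y)| ≤ α) (hVW : ∀ k y, |Real.log (V k y / W k y)| ≤ β)
    (D : (Fin n → Y) → Prop) [DecidablePred D]
    (hD : (∑ z : Fin n → Y with D z, ∏ k, q (z k)) *
      Real.exp (∑ k, relEnt (V k) q + 8 * α * Real.sqrt n) ≤ 1 / 2) :
    1 / 4 * Real.exp (-(∑ k, relEnt (V k) (W k) + 8 * β * Real.sqrt n)) ≤
      ∑ z : Fin n → Y with ¬ D z, ∏ k, W k (z k) := by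
  classical
  have hB1 := sum_prod_large_deviation_le hn (fun k y => (hV k y).le) hV1 hα
    (a := fun k y => Real.log (V k y / q y)) hVq
    (r := ∑ k, relEnt (V k) q + 8 * α * Real.sqrt n) rfl
  have hB2 := sum_prod_large_deviation_le hn (fun k y => (hV k y).le) hV1 hβ
    (a := fun k y => Real.log (V k y / W k y)) hVW
    (r := ∑ k, relEnt (V k) (W k) + 8 * β * Real.sqrt n) rfl
  set r := ∑ k, relEnt (V k) q + 8 * α * Real.sqrt n
  set r' := ∑ k, relEnt (V k) (W k) + 8 * β * Real.sqrt n
  have hbound : ∀ (U : Fin n → Y → ℝ), (∀ k y, 0 < U k y) → ∀ (ρ : ℝ) (z : Fin n → Y),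
      ∑ k, Real.log (V k (z k) / U k (z k)) ≤ ρ →
      ∏ k, V k (z k) ≤ (∏ k, U k (z k)) * Real.exp ρ := by
    intro U hU ρ z hz
    have : ∏ k, V k (z k) = (∏ k, U k (z k)) *
        Real.exp (∑ k, Real.log (V k (z k) / U k (z k))) := by
      rw [Real.exp_sum, ← Finset.prod_mul_distrib]
      refine Finset.prod_congr rfl fun k _ => ?_
      rw [Real.exp_log (div_pos (hV _ _) (hU _ _)), mul_div_cancel₀ _ (hU _ _).ne']
    rw [this]
    exact mul_le_mul_of_nonneg_left (Real.exp_le_exp.2 hz)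
      (Finset.prod_nonneg fun k _ => (hU _ _).le)
  -- The unit mass of `V` is covered by two atypical events of mass at most 1/8 each, the typical
  -- part of `D` of mass at most 1/2, and the typical part of its complement, which must carry the
  -- remaining 1/4.
  have hterm : ∀ z : Fin n → Y, ∏ k, V k (z k) ≤
      (if r < ∑ k, Real.log (V k (z k) / q (z k)) then ∏ k, V k (z k) else 0) +
      (if r' < ∑ k, Real.log (V k (z k) / W k (z k)) then ∏ k, V k (z k) else 0) +
      (if D z then ∏ k, q (z k) else 0) * Real.exp r +
      (if ¬ D z then ∏ k, W k (z k) else 0) * Real.exp r' := by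
    intro z
    have p1 : 0 ≤ ∏ k, V k (z k) := Finset.prod_nonneg fun k _ => (hV _ _).le
    have p2 : 0 ≤ (∏ k, q (z k)) * Real.exp r :=
      mul_nonneg (Finset.prod_nonneg fun k _ => (hq _).le) (Real.exp_pos _).le
    have p3 : 0 ≤ (∏ k, W k (z k)) * Real.exp r' :=
      mul_nonneg (Finset.prod_nonneg fun k _ => (hW _ _).le) (Real.exp_pos _).le
    by_cases c1 : r < ∑ k, Real.log (V k (z k) / q (z k))
    · rw [if_pos c1]
      split_ifs <;> simp only [zero_mul] <;> linarith
    by_cases c2 : r' < ∑ k, Real.log (V k (z k) / W k (z k))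
    · rw [if_pos c2]
      split_ifs <;> simp only [zero_mul] <;> linarith
    rw [if_neg c1, if_neg c2]
    by_cases c3 : D z
    · simpa [c3] using hbound (fun _ => q) (fun _ => hq) r z (not_lt.1 c1)
    · simpa [c3] using hbound W hW r' z (not_lt.1 c2)
  have hsum := Finset.sum_le_sum fun z (_ : z ∈ Finset.univ) => hterm z
  rw [sum_prod_apply, Finset.sum_add_distrib, Finset.sum_add_distrib, Finset.sum_add_distrib,
    ← Finset.sum_mul, ← Finset.sum_mul] at hsum
  simp only [hV1, Finset.prod_const_one] at hsum
  rw [Finset.sum_filter] at hD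
  rw [Finset.sum_filter, Real.exp_neg, ← div_eq_mul_inv, div_le_iff₀ (Real.exp_pos _)]
  linarith

end ChangeOfMeasure

/-! ### Single-letter estimates for nearby laws and their mixtures -/

section SingleLetter

variable {Y : Type*}

/-- The likelihood ratio of `V` and `q` lies between `exp (-u)` and `exp u`. -/
def IsNear (u : ℝ) (V q : Y → ℝ) : Prop :=
  ∀ y, Real.exp (-u) * q y ≤ V y ∧ V y ≤ Real.exp u * q y

/-- The mixture `(1 - t) p + t q`. -/
def mix (t : ℝ) (p q : Y → ℝ) (y : Y) : ℝ := (1 - t) * p y + t * q y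

lemma mix_zero (p q : Y → ℝ) : mix 0 p q = p := by ext; simp [mix]

lemma mix_one (p q : Y → ℝ) : mix 1 p q = q := by ext; simp [mix]

lemma sum_mix [Fintype Y] {p q : Y → ℝ} (hp : ∑ y, p y = 1) (hq : ∑ y, q y = 1) (t : ℝ) :
    ∑ y, mix t p q y = 1 := by
  simp only [mix, Finset.sum_add_distrib, ← Finset.mul_sum, hp, hq]
  ring

lemma le_mix {p q : Y → ℝ} {δ t : ℝ} (ht : t ∈ Icc (0 : ℝ) 1) {y : Y} (hp : δ ≤ p y)
    (hq : δ ≤ q y) : δ ≤ mix t p q y := by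
  have h1 := mul_le_mul_of_nonneg_left hp (sub_nonneg.2 ht.2)
  have h2 := mul_le_mul_of_nonneg_left hq ht.1
  rw [mix]
  linarith

lemma mix_pos {p q : Y → ℝ} {t : ℝ} (ht : t ∈ Icc (0 : ℝ) 1) {y : Y} (hp : 0 < p y)
    (hq : 0 < q y) : 0 < mix t p q y :=
  (lt_min hp hq).trans_le (le_mix ht (min_le_left _ _) (min_le_right _ _))

lemma IsNear.mono {u u' : ℝ} {V q : Y → ℝ} (h : IsNear u V q) (hu : u ≤ u')
    (hq : ∀ y, 0 ≤ q y) : IsNear u' V q := fun y =>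
  ⟨(mul_le_mul_of_nonneg_right (Real.exp_le_exp.2 (neg_le_neg hu)) (hq y)).trans (h y).1,
    (h y).2.trans (mul_le_mul_of_nonneg_right (Real.exp_le_exp.2 hu) (hq y))⟩

lemma IsNear.mix {u t : ℝ} {V q V' q' : Y → ℝ} (ht : t ∈ Icc (0 : ℝ) 1) (h : IsNear u V q)
    (h' : IsNear u V' q') : IsNear u (mix t V V') (mix t q q') := by
  intro y
  have h1 := mul_le_mul_of_nonneg_left (h y).1 (sub_nonneg.2 ht.2)
  have h2 := mul_le_mul_of_nonneg_left (h' y).1 ht.1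
  have h3 := mul_le_mul_of_nonneg_left (h y).2 (sub_nonneg.2 ht.2)
  have h4 := mul_le_mul_of_nonneg_left (h' y).2 ht.1
  simp only [SpherePacking.mix]
  constructor <;> linarith

lemma IsNear.abs_log_le {u : ℝ} {V q : Y → ℝ} (h : IsNear u V q) (hq : ∀ y, 0 < q y) (y : Y) :
    |Real.log (V y / q y)| ≤ u := by
  have hV : 0 < V y := (mul_pos (Real.exp_pos _) (hq y)).trans_le (h y).1
  rw [abs_le]
  constructor
  · rw [Real.le_log_iff_exp_le (div_pos hV (hq y)), le_div_iff₀ (hq y)]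
    exact (h y).1
  · rw [Real.log_le_iff_le_exp (div_pos hV (hq y)), div_le_iff₀ (hq y)]
    exact (h y).2

lemma IsNear.abs_sub_le {u : ℝ} {V q : Y → ℝ} (h : IsNear u V q) (hq : ∀ y, 0 < q y) (y : Y) :
    |V y - q y| ≤ (Real.exp u - 1) * q y := by
  have h1 : 2 ≤ Real.exp u + Real.exp (-u) := by
    have h3 : Real.exp u * Real.exp (-u) = 1 := by rw [← Real.exp_add]; simp
    nlinarith [sq_nonneg (Real.exp u - Real.exp (-u)), Real.exp_pos u, Real.exp_pos (-u)]
  rw [abs_le]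
  have := h y
  constructor <;> nlinarith [hq y]

/-- Relative entropy is at most the chi-square divergence, which is quadratic in the deviation of
V/q from 1. -/
lemma IsNear.relEnt_le [Fintype Y] {u : ℝ} {V q : Y → ℝ} (h : IsNear u V q) (hq : ∀ y, 0 < q y)
    (hV1 : ∑ y, V y = 1) (hq1 : ∑ y, q y = 1) : relEnt V q ≤ (Real.exp u - 1) ^ 2 := by
  have hV : ∀ y, 0 < V y := fun y => (mul_pos (Real.exp_pos _) (hq y)).trans_le (h y).1
  have hterm : ∀ y, V y * Real.log (V y / q y) ≤ (Real.exp u - 1) ^ 2 * q y + (V y - q y) := by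
    intro y
    have h1 := mul_le_mul_of_nonneg_left
      (Real.log_le_sub_one_of_pos (div_pos (hV y) (hq y))) (hV y).le
    have h2 : V y * (V y / q y - 1) = (V y - q y) ^ 2 / q y + (V y - q y) := by
      field_simp [(hq y).ne']
      ring
    have h3 : (V y - q y) ^ 2 / q y ≤ (Real.exp u - 1) ^ 2 * q y := by
      rw [div_le_iff₀ (hq y), ← sq_abs]
      calc _ ≤ ((Real.exp u - 1) * q y) ^ 2 :=
            pow_le_pow_left₀ (abs_nonneg _) (h.abs_sub_le hq y) 2
        _ = _ := by ring
    linarith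
  calc relEnt V q ≤ ∑ y, ((Real.exp u - 1) ^ 2 * q y + (V y - q y)) :=
        Finset.sum_le_sum fun y _ => hterm y
    _ = (Real.exp u - 1) ^ 2 := by
        rw [Finset.sum_add_distrib, Finset.sum_sub_distrib, ← Finset.mul_sum, hV1, hq1]; ring

/-- Tangent inequality: the left side is linear in (v, q) and touches v log(v/q) along the ray v/q =
r. Joint convexity and the increment bound both rest on it. -/
lemma mul_log_add_sub_le {v q r : ℝ} (hv : 0 < v) (hq : 0 < q) (hr : 0 < r) :
    v * Real.log r + v - q * r ≤ v * Real.log (v / q) := by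
  have h1 := Real.log_le_sub_one_of_pos (by positivity : 0 < q * r / v)
  have h2 : Real.log (q * r / v) = Real.log r - Real.log (v / q) := by
    rw [Real.log_div (by positivity) hv.ne', Real.log_mul hq.ne' hr.ne',
      Real.log_div hv.ne' hq.ne']
    ring
  rw [h2] at h1
  have h3 := mul_le_mul_of_nonneg_left h1 hv.le
  have h4 : v * (q * r / v - 1) = q * r - v := by field_simp
  linarith

/-- Joint convexity of the relative entropy. -/
lemma relEnt_mix_le [Fintype Y] {V q V' q' : Y → ℝ} {t : ℝ} (ht : t ∈ Icc (0 : ℝ) 1)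
    (hV : ∀ y, 0 < V y) (hq : ∀ y, 0 < q y) (hV' : ∀ y, 0 < V' y) (hq' : ∀ y, 0 < q' y) :
    relEnt (mix t V V') (mix t q q') ≤ (1 - t) * relEnt V q + t * relEnt V' q' := by
  simp only [relEnt, Finset.mul_sum]
  rw [← Finset.sum_add_distrib]
  refine Finset.sum_le_sum fun y _ => ?_
  have p1 := mix_pos ht (hV y) (hV' y)
  have p2 := mix_pos ht (hq y) (hq' y)
  set r := mix t V V' y / mix t q q' y with hr
  have hr0 : 0 < r := div_pos p1 p2
  have h1 := mul_le_mul_of_nonneg_left (mul_log_add_sub_le (hV y) (hq y) hr0) (sub_nonneg.2 ht.2)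
  have h2 := mul_le_mul_of_nonneg_left (mul_log_add_sub_le (hV' y) (hq' y) hr0) ht.1
  have h3 : mix t q q' y * r = mix t V V' y := mul_div_cancel₀ _ p2.ne'
  simp only [mix] at h3 ⊢
  linarith

/-- The relative entropy grows slowly along segments between pairs with likelihood ratio
close to one. -/
lemma relEnt_mix_sub_le [Fintype Y] {V q V' q' : Y → ℝ} {u t t' : ℝ} (hu : 0 ≤ u) (ht : t ∈ Icc (0 : ℝ) 1)
    (ht' : t' ∈ Icc (0 : ℝ) 1) (htt' : t ≤ t')
    (hq : ∀ y, 0 < q y) (hq' : ∀ y, 0 < q' y)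
    (hV1 : ∑ y, V y = 1) (hq1 : ∑ y, q y = 1) (hV1' : ∑ y, V' y = 1) (hq1' : ∑ y, q' y = 1)
    (h : IsNear u V q) (h' : IsNear u V' q') :
    relEnt (mix t' V V') (mix t' q q') - relEnt (mix t V V') (mix t q q') ≤
      (t' - t) * (4 * u * (Real.exp u - 1)) := by
  have hV : ∀ y, 0 < V y := fun y => (mul_pos (Real.exp_pos _) (hq y)).trans_le (h y).1
  have hV' : ∀ y, 0 < V' y := fun y => (mul_pos (Real.exp_pos _) (hq' y)).trans_le (h' y).1
  have hn := IsNear.mix ht' h h'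
  have hqt : ∀ y, 0 < mix t' q q' y := fun y => mix_pos ht' (hq y) (hq' y)
  have he : 0 ≤ Real.exp u - 1 := by linarith [Real.one_le_exp hu]
  have hτ : 0 ≤ t' - t := sub_nonneg.2 htt'
  -- The tangent at t' has slope log r · ((V'-q') - (V-q)) + (log r + 1 - r)(q'-q) + ((V'-V) -
  -- (q'-q)). The first two terms are of second order in u; the last sums to zero over the alphabet.
  have hterm : ∀ y, mix t' V V' y * Real.log (mix t' V V' y / mix t' q q' y) -
      mix t V V' y * Real.log (mix t V V' y / mix t q q' y) ≤
      (t' - t) * (2 * u * (Real.exp u - 1) * (q y + q' y)) +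
        (t' - t) * ((V' y - V y) - (q' y - q y)) := by
    intro y
    have p1 := mix_pos ht' (hV y) (hV' y)
    have p2 := hqt y
    set r := mix t' V V' y / mix t' q q' y with hr
    have hr0 : 0 < r := div_pos p1 p2
    have h1 := mul_log_add_sub_le (mix_pos ht (hV y) (hV' y)) (mix_pos ht (hq y) (hq' y)) hr0
    have h3 : mix t' q q' y * r = mix t' V V' y := mul_div_cancel₀ _ p2.ne'
    have hlog : |Real.log r| ≤ u := hn.abs_log_le hqt y
    have hr1 : |r - 1| ≤ Real.exp u - 1 := by
      have := hn.abs_sub_le hqt y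
      rw [hr, div_sub_one p2.ne', abs_div, abs_of_pos p2, div_le_iff₀ p2]
      exact this
    have b1 : |Real.log r + 1 - r| ≤ u * (Real.exp u - 1) := by
      have l1 := Real.log_le_sub_one_of_pos hr0
      have l2 := Real.one_sub_inv_le_log_of_pos hr0
      have l3 := mul_le_mul_of_nonneg_left l2 hr0.le
      rw [mul_sub, mul_one, mul_inv_cancel₀ hr0.ne'] at l3
      have l4 : Real.log r * (r - 1) ≤ u * (Real.exp u - 1) :=
        (le_abs_self _).trans (by rw [abs_mul]; exact mul_le_mul hlog hr1 (abs_nonneg _) hu)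
      rw [abs_le]
      constructor <;> nlinarith [mul_nonneg hu he]
    have d1 : |(V' y - q' y) - (V y - q y)| ≤ (Real.exp u - 1) * (q y + q' y) := by
      have := (abs_sub (V' y - q' y) (V y - q y)).trans
        (add_le_add (h'.abs_sub_le hq' y) (h.abs_sub_le hq y))
      linarith
    have d2 : |q' y - q y| ≤ q y + q' y := by
      rw [abs_le]; constructor <;> linarith [hq y, hq' y]
    have e1 : Real.log r * ((V' y - q' y) - (V y - q y)) ≤
        u * ((Real.exp u - 1) * (q y + q' y)) :=
      (le_abs_self _).trans (by rw [abs_mul]; exact mul_le_mul hlog d1 (abs_nonneg _) hu)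
    have e2 : (Real.log r + 1 - r) * (q' y - q y) ≤ u * (Real.exp u - 1) * (q y + q' y) :=
      (le_abs_self _).trans (by
        rw [abs_mul]; exact mul_le_mul b1 d2 (abs_nonneg _) (mul_nonneg hu he))
    have e3 := mul_le_mul_of_nonneg_left (add_le_add e1 e2) hτ
    have e4 : mix t' V V' y - mix t V V' y = (t' - t) * (V' y - V y) := by simp only [mix]; ring
    have e5 : mix t' q q' y - mix t q q' y = (t' - t) * (q' y - q y) := by simp only [mix]; ring
    have e6 : mix t' V V' y = mix t V V' y + (t' - t) * (V' y - V y) := by linarith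
    have e7 : mix t q q' y = mix t' q q' y - (t' - t) * (q' y - q y) := by linarith
    have e9 : mix t q q' y * r = mix t' q q' y * r - (t' - t) * (q' y - q y) * r := by
      rw [e7]; ring
    have e8 : mix t' V V' y * Real.log r = mix t V V' y * Real.log r +
      (t' - t) * (V' y - V y) * Real.log r := by rw [e6]; ring
    rw [e8]
    linarith
  calc _ = ∑ y, (mix t' V V' y * Real.log (mix t' V V' y / mix t' q q' y) -
      mix t V V' y * Real.log (mix t V V' y / mix t q q' y)) := by
        rw [Finset.sum_sub_distrib]; rfl
    _ ≤ _ := Finset.sum_le_sum fun y _ => hterm y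
    _ = _ := by
        rw [Finset.sum_add_distrib, ← Finset.mul_sum, ← Finset.mul_sum, ← Finset.mul_sum,
          Finset.sum_add_distrib, Finset.sum_sub_distrib, Finset.sum_sub_distrib,
          Finset.sum_sub_distrib, hV1, hq1, hV1', hq1']
        ring

lemma exp_mul_sub_one_le {κ θ : ℝ} (hθ : θ ∈ Icc (0 : ℝ) 1) :
    Real.exp (κ * θ) - 1 ≤ (Real.exp κ - 1) * θ := by
  have := convexOn_exp.2 (mem_univ 0) (mem_univ κ) (sub_nonneg.2 hθ.2) hθ.1 (by ring)
  simp only [smul_eq_mul, mul_zero, zero_add, Real.exp_zero, mul_one] at this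
  rw [mul_comm θ κ] at this
  linarith

/-- The ratio tilt/q is w^θ / (q^θ · affinity), and all three quantities lie in [δ^θ, 1]. -/
lemma isNear_tilt [Fintype Y] {w q : Y → ℝ} {δ θ : ℝ} (hδ : 0 < δ) (hθ : θ ∈ Icc (0 : ℝ) 1)
    (hw : w ∈ stdSimplex ℝ Y) (hq : q ∈ stdSimplex ℝ Y) (hwδ : ∀ y, δ ≤ w y)
    (hqδ : ∀ y, δ ≤ q y) : IsNear (-2 * Real.log δ * θ) (tilt (1 - θ) w q) q := by
  intro y
  have hw0 := hδ.trans_le (hwδ y)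
  have hq0 := hδ.trans_le (hqδ y)
  have hA1 : affinity (1 - θ) w q ≤ 1 :=
    affinity_le_one (by linarith [hθ.2]) (by linarith [hθ.1]) hw hq
  have hA2 : δ ^ θ ≤ affinity (1 - θ) w q := by
    simpa using rpow_le_affinity hδ (by linarith [hθ.1] : 1 - θ ≤ 1) hwδ hq
  have hδθ : 0 < δ ^ θ := Real.rpow_pos_of_pos hδ θ
  have hA0 := hδθ.trans_le hA2
  have hδ1 : δ ≤ 1 := (hqδ y).trans (le_one_of_mem_stdSimplex hq y)
  have hδθ1 : δ ^ θ ≤ 1 := Real.rpow_le_one hδ.le hδ1 hθ.1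
  have hexp : Real.exp (-2 * Real.log δ * θ) = (δ ^ θ)⁻¹ * (δ ^ θ)⁻¹ := by
    rw [← Real.rpow_neg hδ.le, ← Real.rpow_add hδ, Real.rpow_def_of_pos hδ]
    congr 1; ring
  have hexp' : Real.exp (-(-2 * Real.log δ * θ)) = δ ^ θ * δ ^ θ := by
    rw [Real.exp_neg, hexp]; simp
  have hwθ : δ ^ θ ≤ w y ^ θ := Real.rpow_le_rpow hδ.le (hwδ y) hθ.1
  have hwθ1 : w y ^ θ ≤ 1 := Real.rpow_le_one hw0.le (le_one_of_mem_stdSimplex hw y) hθ.1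
  have hqθ : δ ^ θ ≤ q y ^ θ := Real.rpow_le_rpow hδ.le (hqδ y) hθ.1
  have hqθ1 : q y ^ θ ≤ 1 := Real.rpow_le_one hq0.le (le_one_of_mem_stdSimplex hq y) hθ.1
  have hqθ0 := hδθ.trans_le hqθ
  have hV : tilt (1 - θ) w q y = w y ^ θ / (q y ^ θ * affinity (1 - θ) w q) * q y := by
    rw [tilt, sub_sub_cancel, Real.rpow_sub hq0, Real.rpow_one]
    field_simp
  rw [hV, hexp, hexp']
  refine ⟨mul_le_mul_of_nonneg_right ?_ hq0.le, mul_le_mul_of_nonneg_right ?_ hq0.le⟩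
  · rw [le_div_iff₀ (mul_pos hqθ0 hA0)]
    have h1 : q y ^ θ * affinity (1 - θ) w q ≤ 1 := mul_le_one₀ hqθ1 hA0.le hA1
    have h2 : δ ^ θ * δ ^ θ ≤ δ ^ θ := mul_le_of_le_one_left hδθ.le hδθ1
    nlinarith [mul_pos hδθ hδθ]
  · rw [div_le_iff₀ (mul_pos hqθ0 hA0)]
    have h1 : δ ^ θ * δ ^ θ ≤ q y ^ θ * affinity (1 - θ) w q :=
      mul_le_mul hqθ hA2 hδθ.le hqθ0.le
    calc w y ^ θ ≤ 1 := hwθ1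
      _ = (δ ^ θ)⁻¹ * (δ ^ θ)⁻¹ * (δ ^ θ * δ ^ θ) := by field_simp
      _ ≤ _ := mul_le_mul_of_nonneg_left h1 (by positivity)

lemma abs_log_div_le {v w ε : ℝ} (hε : 0 < ε) (hv : ε ≤ v) (hv1 : v ≤ 1) (hw : ε ≤ w)
    (hw1 : w ≤ 1) : |Real.log (v / w)| ≤ -Real.log ε := by
  have hv0 := hε.trans_le hv
  have hw0 := hε.trans_le hw
  rw [Real.log_div hv0.ne' hw0.ne', abs_le]
  have h1 := Real.log_le_log hε hv
  have h2 := Real.log_le_log hε hw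
  have h3 := Real.log_nonpos hv0.le hv1
  have h4 := Real.log_nonpos hw0.le hw1
  constructor <;> linarith

end SingleLetter

/-! ### The minimax exponent as a function of s, including s = 0 -/

section ExponentFunction

variable {X Y : Type*} [Fintype X] [Fintype Y] {W : X → Y → ℝ} {δ : ℝ}

/-- `E s` is, for `0 < s < 1`, the minimax value
`max_p min_q ∑ p(x) (-log ∑ W_x ^ (1 - s) q ^ s) / (1 - s)`; it is `0` at `s = 0`. The minimizing
`q` is bounded below by `δ`. -/
structure IsMinimaxExponent (W : X → Y → ℝ) (δ : ℝ) (E : ℝ → ℝ) : Prop where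
  exists_le : ∀ s ∈ Ico (0 : ℝ) 1, ∃ q ∈ stdSimplex ℝ Y, (∀ y, δ ≤ q y) ∧
    ∀ x, -Real.log (affinity s (W x) q) ≤ (1 - s) * E s
  le_of_forall : ∀ s ∈ Ico (0 : ℝ) 1, ∀ q ∈ stdSimplex ℝ Y, ∀ c,
    (∀ x, -Real.log (affinity s (W x) q) ≤ (1 - s) * c) → E s ≤ c
  le_spExponent : ∀ s ∈ Ico (0 : ℝ) 1, ∀ a b ψ, 0 < a → Admissible a b ψ → ∀ R : ℝ,
    ((E s - s / (1 - s) * R : ℝ) : EReal) ≤ spExponent ψ W R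

lemma exists_isMinimaxExponent [Nonempty X] (hδ : 0 < δ) (hδ1 : δ ≤ 1)
    (hW : ∀ x, W x ∈ stdSimplex ℝ Y) (hWδ : ∀ x y, δ ≤ W x y) :
    ∃ E, IsMinimaxExponent W δ E := by
  have hW0 : ∀ x y, 0 < W x y := fun x y => hδ.trans_le (hWδ x y)
  have h := fun s (hs : s ∈ Ioo (0 : ℝ) 1) => exists_saddle hs hδ hδ1 hW hWδ
  choose! v p hp q hq hqδ hle hge using h
  have hv0 : ∀ s ∈ Ioo (0 : ℝ) 1, 0 ≤ v s := fun s hs =>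
    (neg_nonneg.2 (Real.log_nonpos ((by positivity : 0 ≤ δ ^ (1 - s)).trans
        (rpow_le_affinity hδ hs.2.le (hWδ (Classical.arbitrary X)) (hq s hs)))
      (affinity_le_one hs.1.le hs.2.le (hW _) (hq s hs)))).trans (hle s hs _)
  have haff0 : ∀ x q, affinity 0 (W x) q = 1 := fun x q => by simp [affinity, (hW x).2]
  refine ⟨fun s => if s = 0 then 0 else v s / (1 - s), ⟨fun s hs => ?_, fun s hs q' hq' c hc => ?_,
    fun s hs a b ψ ha hψ R => ?_⟩⟩
  · rcases eq_or_ne s 0 with rfl | h0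
    · exact ⟨W (Classical.arbitrary X), hW _, hWδ _, fun x => by simp [haff0]⟩
    · have hs' : s ∈ Ioo (0 : ℝ) 1 := ⟨lt_of_le_of_ne hs.1 h0.symm, hs.2⟩
      refine ⟨q s, hq s hs', hqδ s hs', fun x => ?_⟩
      rw [if_neg h0, mul_div_cancel₀ _ (by linarith [hs.2])]
      exact hle s hs' x
  · rcases eq_or_ne s 0 with rfl | h0
    · simpa [haff0] using hc (Classical.arbitrary X)
    · have hs' : s ∈ Ioo (0 : ℝ) 1 := ⟨lt_of_le_of_ne hs.1 h0.symm, hs.2⟩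
      simp only [if_neg h0]
      rw [div_le_iff₀ (by linarith [hs.2])]
      refine (hge s hs' q' hq').trans ?_
      calc _ ≤ ∑ x, p s x * ((1 - s) * c) := Finset.sum_le_sum fun x _ =>
            mul_le_mul_of_nonneg_left (hc x) ((hp s hs').1 x)
        _ = c * (1 - s) := by rw [← Finset.sum_mul, (hp s hs').2]; ring
  · rcases eq_or_ne s 0 with rfl | h0
    -- The supremum in `spExponent` omits s = 0, so this endpoint is a limit s → 0+, with the
    -- nonnegative term v(s)/(1-s) dropped.
    · have ht : Tendsto (fun s : ℝ => ((-(s / (1 - s) * R) : ℝ) : EReal)) (nhdsWithin 0 (Ioi 0))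
          (nhds ((0 - 0 / (1 - 0) * R : ℝ) : EReal)) := by
        refine (continuous_coe_real_ereal.tendsto _).comp (tendsto_nhdsWithin_of_tendsto_nhds ?_)
        have : ContinuousAt (fun s : ℝ => -(s / (1 - s) * R)) 0 := by
          refine ((continuousAt_id.div (continuousAt_const.sub continuousAt_id) ?_).mul
            continuousAt_const).neg
          simp
        simpa [ContinuousAt] using this
      simp only [if_true]
      refine le_of_tendsto ht ?_
      filter_upwards [Ioo_mem_nhdsGT (zero_lt_one' ℝ)] with s hs
      refine le_trans (EReal.coe_le_coe_iff.2 ?_)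
        (coe_le_spExponent hψ ha hs hW hW0 (hp s hs) (hge s hs) R)
      have : 0 ≤ v s / (1 - s) := div_nonneg (hv0 s hs) (by linarith [hs.2])
      linarith
    · have hs' : s ∈ Ioo (0 : ℝ) 1 := ⟨lt_of_le_of_ne hs.1 h0.symm, hs.2⟩
      simp only [if_neg h0]
      exact coe_le_spExponent hψ ha hs' hW hW0 (hp s hs') (hge s hs') R

namespace IsMinimaxExponent

variable {E : ℝ → ℝ} {s : ℝ}

lemma nonneg [Nonempty X] (hE : IsMinimaxExponent W δ E) (hδ : 0 < δ)
    (hW : ∀ x, W x ∈ stdSimplex ℝ Y) (hWδ : ∀ x y, δ ≤ W x y) (hs : s ∈ Ico (0 : ℝ) 1) :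
    0 ≤ E s := by
  obtain ⟨q, hq, -, h⟩ := hE.exists_le s hs
  have h1 := (neg_nonneg.2 (Real.log_nonpos ((by positivity : 0 ≤ δ ^ (1 - s)).trans
    (rpow_le_affinity hδ hs.2.le (hWδ (Classical.arbitrary X)) hq))
      (affinity_le_one hs.1 hs.2.le (hW _) hq))).trans (h _)
  by_contra! hc
  nlinarith [hs.2]

lemma le_neg_log [Nonempty X] (hE : IsMinimaxExponent W δ E) (hδ : 0 < δ)
    (hW : ∀ x, W x ∈ stdSimplex ℝ Y) (hWδ : ∀ x y, δ ≤ W x y) (hs : s ∈ Ico (0 : ℝ) 1) :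
    E s ≤ -Real.log δ := by
  refine hE.le_of_forall s hs _ (hW (Classical.arbitrary X)) _ fun x => ?_
  have := Real.log_le_log (by positivity)
    (rpow_le_affinity hδ hs.2.le (hWδ x) (hW (Classical.arbitrary X)))
  rw [Real.log_rpow hδ] at this
  linarith

end IsMinimaxExponent

end ExponentFunction

/-! ### Discrete intermediate value and choice of the message -/

lemma exists_lt_and_not_succ {P : ℕ → Prop} {N : ℕ} (h0 : P 0) (hN : ¬ P N) :
    ∃ j < N, P j ∧ ¬ P (j + 1) := by
  induction N with
  | zero => exact absurd h0 hN
  | succ N ih =>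
    by_cases h : P N
    · exact ⟨N, N.lt_succ_self, h, hN⟩
    · obtain ⟨j, hj, h'⟩ := ih h
      exact ⟨j, hj.trans N.lt_succ_self, h'⟩

/-- Some decoding region is unlikely under all members of a weighted family of product
distributions at once. -/
lemma exists_forall_mul_sum_le {Y ι : Type*} [Fintype Y] {n M : ℕ} (hM : 0 < M) (I : Finset ι)
    {w : ι → ℝ} (hw : ∀ i, 0 ≤ w i) (hw1 : ∑ i ∈ I, w i ≤ 1) {q : ι → Y → ℝ}
    (hq : ∀ i ∈ I, ∀ y, 0 ≤ q i y) (hq1 : ∀ i, ∑ y, q i y = 1) (dec : (Fin n → Y) → Fin M) :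
    ∃ m, ∀ i ∈ I, w i * ∑ z : Fin n → Y with dec z = m, ∏ k, q i (z k) ≤ 1 / M := by
  have : Nonempty (Fin M) := ⟨⟨0, hM⟩⟩
  by_contra! hcon
  have hnn : ∀ i ∈ I, ∀ m, 0 ≤ w i * ∑ z : Fin n → Y with dec z = m, ∏ k, q i (z k) :=
    fun i hi m => mul_nonneg (hw i)
      (Finset.sum_nonneg fun z _ => Finset.prod_nonneg fun k _ => hq i hi _)
  have h1 : ∀ m, 1 / (M : ℝ) < ∑ i ∈ I, w i * ∑ z : Fin n → Y with dec z = m, ∏ k, q i (z k) := by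
    intro m
    obtain ⟨i, hi, h⟩ := hcon m
    exact h.trans_le (Finset.single_le_sum (f := fun i =>
      w i * ∑ z : Fin n → Y with dec z = m, ∏ k, q i (z k)) (fun i hi => hnn i hi m) hi)
  have h2 := Finset.sum_lt_sum_of_nonempty Finset.univ_nonempty
    fun m (_ : m ∈ Finset.univ) => h1 m
  rw [Finset.sum_comm] at h2
  simp_rw [← Finset.mul_sum] at h2
  have h3 : ∀ i, ∑ m, ∑ z : Fin n → Y with dec z = m, ∏ k, q i (z k) = 1 := by
    intro i
    rw [Finset.sum_fiberwise, sum_prod_apply fun _ => q i]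
    simp [hq1]
  simp_rw [h3, mul_one] at h2
  simp only [Finset.sum_const, Finset.card_univ, Fintype.card_fin, nsmul_eq_mul] at h2
  rw [mul_one_div_cancel (by exact_mod_cast hM.ne')] at h2
  linarith

/-! ### Optimal output laws at grid parameters and the segments between them -/

section Anchors

variable {X Y : Type*} [Fintype Y] {W : X → Y → ℝ} {δ : ℝ} {E : ℝ → ℝ}

/-- `q` attains the minimax exponent at `s = 1 - θ` and is bounded below by `δ`. -/
structure IsAnchor (W : X → Y → ℝ) (δ : ℝ) (E : ℝ → ℝ) (θ : ℝ) (q : Y → ℝ) : Prop where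
  mem : q ∈ stdSimplex ℝ Y
  le : ∀ y, δ ≤ q y
  neg_log_le : ∀ x, -Real.log (affinity (1 - θ) (W x) q) ≤ θ * E (1 - θ)

lemma IsMinimaxExponent.exists_isAnchor [Fintype X] (hE : IsMinimaxExponent W δ E) {θ : ℝ}
    (hθ : θ ∈ Ioc (0 : ℝ) 1) : ∃ q, IsAnchor W δ E θ q := by
  obtain ⟨q, hq, hqδ, h⟩ := hE.exists_le (1 - θ) ⟨by linarith [hθ.2], by linarith [hθ.1]⟩
  exact ⟨q, hq, hqδ, by simpa using h⟩

namespace IsAnchor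

variable {θ θ' : ℝ} {q q' : Y → ℝ}

lemma pos (h : IsAnchor W δ E θ q) (hδ : 0 < δ) (y : Y) : 0 < q y := hδ.trans_le (h.le y)

lemma nonempty (h : IsAnchor W δ E θ q) : Nonempty Y := by
  by_contra hne
  rw [not_nonempty_iff] at hne
  simpa using h.mem.2

/-- The equality case of the variational formula, divided by θ; note 1/θ - 1 = s/(1-s). -/
lemma relEnt_add_le (h : IsAnchor W δ E θ q) (hδ : 0 < δ) (hWδ : ∀ x y, δ ≤ W x y)
    (hθ : θ ∈ Ioc (0 : ℝ) 1) (x : X) :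
    relEnt (tilt (1 - θ) (W x) q) (W x) + (1 / θ - 1) * relEnt (tilt (1 - θ) (W x) q) q ≤
      E (1 - θ) := by
  have := h.nonempty
  have h1 := h.neg_log_le x
  rw [← relEnt_tilt (s := 1 - θ) (fun y => hδ.trans_le (hWδ x y)) (h.pos hδ), sub_sub_cancel] at h1
  have hθ0 := hθ.1
  refine le_of_mul_le_mul_left (le_trans (le_of_eq ?_) h1) hθ0
  field_simp

lemma relEnt_tilt_le (h : IsAnchor W δ E θ q) (hδ : 0 < δ) (hW : ∀ x, W x ∈ stdSimplex ℝ Y)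
    (hWδ : ∀ x y, δ ≤ W x y) (hθ : θ ∈ Ioc (0 : ℝ) 1) (x : X) :
    relEnt (tilt (1 - θ) (W x) q) q ≤ ((Real.exp (-2 * Real.log δ) - 1) * θ) ^ 2 := by
  have := h.nonempty
  have hn := isNear_tilt hδ ⟨hθ.1.le, hθ.2⟩ (hW x) h.mem (hWδ x) h.le
  refine (hn.relEnt_le (h.pos hδ) (sum_tilt (fun y => hδ.trans_le (hWδ x y)) (h.pos hδ))
    h.mem.2).trans (pow_le_pow_left₀ ?_ (exp_mul_sub_one_le ⟨hθ.1.le, hθ.2⟩) 2)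
  obtain ⟨y⟩ := h.nonempty
  have := Real.log_nonpos hδ.le ((h.le y).trans (le_one_of_mem_stdSimplex h.mem y))
  have : 0 ≤ -2 * Real.log δ * θ := mul_nonneg (by linarith) hθ.1.le
  linarith [Real.one_le_exp this]

/-- The minimax exponent varies slowly. -/
lemma exponent_le [Fintype X] (h' : IsAnchor W δ E θ' q') (hE : IsMinimaxExponent W δ E) (hδ : 0 < δ)
    (hW : ∀ x, W x ∈ stdSimplex ℝ Y) (hWδ : ∀ x y, δ ≤ W x y) (hθ : θ ∈ Ioc (0 : ℝ) 1)
    (hθ' : θ' ∈ Ioc (0 : ℝ) 1) (hle : θ ≤ θ') :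
    E (1 - θ) ≤ E (1 - θ') +
      (1 / θ - 1 / θ') * ((Real.exp (-2 * Real.log δ) - 1) * θ') ^ 2 := by
  have := h'.nonempty
  -- The law q' and its tilts at θ' compete at θ. Only the weight of D(V‖q') changes, from 1/θ' - 1
  -- to 1/θ - 1, and that divergence is O(θ'²).
  refine hE.le_of_forall _ ⟨by linarith [hθ.2], by linarith [hθ.1]⟩ q' h'.mem _ fun x => ?_
  have hw : ∀ y, 0 < W x y := fun y => hδ.trans_le (hWδ x y)
  refine (neg_log_affinity_le hw (h'.pos hδ) (tilt_pos (s := 1 - θ') hw (h'.pos hδ))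
    (sum_tilt hw (h'.pos hδ))).trans ?_
  have h1 := h'.relEnt_add_le hδ hWδ hθ' x
  have h2 := h'.relEnt_tilt_le hδ hW hWδ hθ' x
  have hθ0 := hθ.1
  have hinv : 0 ≤ 1 / θ - 1 / θ' := sub_nonneg.2 (one_div_le_one_div_of_le hθ0 hle)
  have h3 := mul_le_mul_of_nonneg_left (add_le_add h1 (mul_le_mul_of_nonneg_left h2 hinv)) hθ0.le
  rw [sub_sub_cancel]
  refine le_trans (le_of_eq ?_) h3
  field_simp
  ring

/-- Joint convexity reduces to the two ends. At the end θ the weight 1/θ' - 1 is at most 1/θ - 1,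
and `exponent_le` replaces E(1-θ) by E(1-θ'). -/
lemma relEnt_mix_add_le [Fintype X] (h : IsAnchor W δ E θ q) (h' : IsAnchor W δ E θ' q')
    (hE : IsMinimaxExponent W δ E) (hδ : 0 < δ)
    (hW : ∀ x, W x ∈ stdSimplex ℝ Y) (hWδ : ∀ x y, δ ≤ W x y) (hθ : θ ∈ Ioc (0 : ℝ) 1)
    (hθ' : θ' ∈ Ioc (0 : ℝ) 1) (hle : θ ≤ θ') {t : ℝ} (ht : t ∈ Icc (0 : ℝ) 1) (x : X) :
    relEnt (mix t (tilt (1 - θ) (W x) q) (tilt (1 - θ') (W x) q')) (W x) +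
      (1 / θ' - 1) * relEnt (mix t (tilt (1 - θ) (W x) q) (tilt (1 - θ') (W x) q')) (mix t q q') ≤
      E (1 - θ') + (1 / θ - 1 / θ') * ((Real.exp (-2 * Real.log δ) - 1) * θ') ^ 2 := by
  have := h.nonempty
  have hw : ∀ y, 0 < W x y := fun y => hδ.trans_le (hWδ x y)
  have p := tilt_pos (s := 1 - θ) hw (h.pos hδ)
  have p' := tilt_pos (s := 1 - θ') hw (h'.pos hδ)
  have hWmix : mix t (W x) (W x) = W x := by ext; simp only [mix]; ring
  have c1 := relEnt_mix_le ht p hw p' hw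
  rw [hWmix] at c1
  have c2 := relEnt_mix_le ht p (h.pos hδ) p' (h'.pos hδ)
  have hρ' : 0 ≤ 1 / θ' - 1 := by
    rw [sub_nonneg, one_le_div hθ'.1]; exact hθ'.2
  have hinv : 1 / θ' - 1 ≤ 1 / θ - 1 := by
    linarith [one_div_le_one_div_of_le hθ.1 hle]
  have e1 := h.relEnt_add_le hδ hWδ hθ x
  have e2 := h'.relEnt_add_le hδ hWδ hθ' x
  have e3 := h'.exponent_le hE hδ hW hWδ hθ hθ' hle
  have hnn : 0 ≤ relEnt (tilt (1 - θ) (W x) q) q :=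
    relEnt_nonneg (fun y => (p y).le) (h.pos hδ) (by rw [sum_tilt hw (h.pos hδ), h.mem.2])
  have e4 := mul_le_mul_of_nonneg_right hinv hnn
  have hsq : 0 ≤ (1 / θ - 1 / θ') * ((Real.exp (-2 * Real.log δ) - 1) * θ') ^ 2 :=
    mul_nonneg (by linarith) (sq_nonneg _)
  have f1 := mul_le_mul_of_nonneg_left ((add_le_add_right e4 _).trans (e1.trans e3))
    (sub_nonneg.2 ht.2)
  have f2 := mul_le_mul_of_nonneg_left (e2.trans (le_add_of_nonneg_right hsq)) ht.1
  have f3 := mul_le_mul_of_nonneg_left c2 hρ'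
  linarith

lemma isNear_mix (h : IsAnchor W δ E θ q) (h' : IsAnchor W δ E θ' q') (hδ : 0 < δ)
    (hW : ∀ x, W x ∈ stdSimplex ℝ Y) (hWδ : ∀ x y, δ ≤ W x y) (hθ : θ ∈ Ioc (0 : ℝ) 1)
    (hθ' : θ' ∈ Ioc (0 : ℝ) 1) (hle : θ ≤ θ') (x : X) :
    IsNear (-2 * Real.log δ * θ') (tilt (1 - θ) (W x) q) q ∧
      IsNear (-2 * Real.log δ * θ') (tilt (1 - θ') (W x) q') q' := by
  obtain ⟨y⟩ := h.nonempty
  have := Real.log_nonpos hδ.le ((h.le y).trans (le_one_of_mem_stdSimplex h.mem y))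
  exact ⟨(isNear_tilt hδ ⟨hθ.1.le, hθ.2⟩ (hW x) h.mem (hWδ x) h.le).mono
    (mul_le_mul_of_nonneg_left hle (by linarith)) h.mem.1,
    isNear_tilt hδ ⟨hθ'.1.le, hθ'.2⟩ (hW x) h'.mem (hWδ x) h'.le⟩

lemma relEnt_mix_step_le (h : IsAnchor W δ E θ q) (h' : IsAnchor W δ E θ' q') (hδ : 0 < δ)
    (hW : ∀ x, W x ∈ stdSimplex ℝ Y) (hWδ : ∀ x y, δ ≤ W x y) (hθ : θ ∈ Ioc (0 : ℝ) 1)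
    (hθ' : θ' ∈ Ioc (0 : ℝ) 1) (hle : θ ≤ θ') {t t' : ℝ} (ht : t ∈ Icc (0 : ℝ) 1)
    (ht' : t' ∈ Icc (0 : ℝ) 1) (htt' : t ≤ t') (x : X) :
    relEnt (mix t' (tilt (1 - θ) (W x) q) (tilt (1 - θ') (W x) q')) (mix t' q q') -
      relEnt (mix t (tilt (1 - θ) (W x) q) (tilt (1 - θ') (W x) q')) (mix t q q') ≤
      (t' - t) * (4 * (-2 * Real.log δ) * (Real.exp (-2 * Real.log δ) - 1)) * θ' ^ 2 := by
  have := h.nonempty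
  have hw : ∀ y, 0 < W x y := fun y => hδ.trans_le (hWδ x y)
  obtain ⟨n1, n2⟩ := h.isNear_mix h' hδ hW hWδ hθ hθ' hle x
  obtain ⟨y⟩ := h.nonempty
  have hlog := Real.log_nonpos hδ.le ((h.le y).trans (le_one_of_mem_stdSimplex h.mem y))
  have hu : 0 ≤ -2 * Real.log δ * θ' := mul_nonneg (by linarith) hθ'.1.le
  refine (relEnt_mix_sub_le hu ht ht' htt' (h.pos hδ) (h'.pos hδ) (sum_tilt hw (h.pos hδ))
    h.mem.2 (sum_tilt hw (h'.pos hδ)) h'.mem.2 n1 n2).trans ?_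
  have e := mul_le_mul_of_nonneg_left (exp_mul_sub_one_le (κ := -2 * Real.log δ)
    ⟨hθ'.1.le, hθ'.2⟩) (by positivity : 0 ≤ 4 * (-2 * Real.log δ * θ'))
  have e' := mul_le_mul_of_nonneg_left e (sub_nonneg.2 htt')
  linarith

/-- The lower bound on the error probability that a point of the segment between two anchors
provides. -/
lemma le_errorProb (h : IsAnchor W δ E θ q) (h' : IsAnchor W δ E θ' q') (hδ : 0 < δ)
    (hδ1 : δ < 1) (hW : ∀ x, W x ∈ stdSimplex ℝ Y) (hWδ : ∀ x y, δ ≤ W x y)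
    (hθ : θ ∈ Ioc (0 : ℝ) 1) (hθ' : θ' ∈ Ioc (0 : ℝ) 1) (hle : θ ≤ θ') {t : ℝ}
    (ht : t ∈ Icc (0 : ℝ) 1) {n M : ℕ} (hn : 0 < n) (c : BlockCode X Y n M) (m : Fin M)
    {w : ℝ} (hw0 : 0 < w)
    (hw : w * ∑ z : Fin n → Y with c.dec z = m, ∏ k, mix t q q' (z k) ≤ 1 / M)
    (hg : ∑ k, relEnt (mix t (tilt (1 - θ) (W (c.enc m k)) q)
      (tilt (1 - θ') (W (c.enc m k)) q')) (mix t q q') +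
      8 * (-2 * Real.log δ * θ') * Real.sqrt n - Real.log w + Real.log 2 ≤ Real.log M) :
    1 / 4 * Real.exp (-(∑ k, relEnt (mix t (tilt (1 - θ) (W (c.enc m k)) q)
      (tilt (1 - θ') (W (c.enc m k)) q')) (W (c.enc m k)) +
      8 * (-3 * Real.log δ) * Real.sqrt n)) ≤ errorProb W c m := by
  have := h.nonempty
  have hM : (0 : ℝ) < M := by exact_mod_cast m.pos
  have hw' : ∀ x y, 0 < W x y := fun x y => hδ.trans_le (hWδ x y)
  have hlog : Real.log δ < 0 := Real.log_neg hδ hδ1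
  have hqp : ∀ y, 0 < mix t q q' y := fun y => mix_pos ht (h.pos hδ y) (h'.pos hδ y)
  have hnear : ∀ x, IsNear (-2 * Real.log δ * θ')
      (mix t (tilt (1 - θ) (W x) q) (tilt (1 - θ') (W x) q')) (mix t q q') := fun x =>
    IsNear.mix ht (h.isNear_mix h' hδ hW hWδ hθ hθ' hle x).1
      (h.isNear_mix h' hδ hW hWδ hθ hθ' hle x).2
  have hVp : ∀ x y, 0 < mix t (tilt (1 - θ) (W x) q) (tilt (1 - θ') (W x) q') y := fun x y =>
    mix_pos ht (tilt_pos (hw' x) (h.pos hδ) y) (tilt_pos (hw' x) (h'.pos hδ) y)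
  have hV1 : ∀ x, ∑ y, mix t (tilt (1 - θ) (W x) q) (tilt (1 - θ') (W x) q') y = 1 := fun x =>
    sum_mix (sum_tilt (hw' x) (h.pos hδ)) (sum_tilt (hw' x) (h'.pos hδ)) t
  have hε : Real.exp (2 * Real.log δ) * δ = Real.exp (3 * Real.log δ) := by
    nth_rewrite 2 [← Real.exp_log hδ]
    rw [← Real.exp_add]; congr 1; ring
  refine exp_neg_relEnt_le_sum_compl hn (fun k => hVp (c.enc m k)) (fun k => hV1 _)
    (fun k => hw' _) hqp (mul_pos (by linarith) hθ'.1) (by linarith)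
    (fun k => (hnear _).abs_log_le hqp) (fun k y => ?_) (fun z => c.dec z = m) ?_
  -- The 3 arises because the mixed tilt is at least δ^(2θ') times the mixed output law, hence at
  -- least δ³.
  · have hlog3 : -3 * Real.log δ = -Real.log (Real.exp (3 * Real.log δ)) := by
      rw [Real.log_exp]; ring
    rw [hlog3]
    refine abs_log_div_le (Real.exp_pos _) ?_ ?_ ?_ (le_one_of_mem_stdSimplex (hW _) y)
    · rw [← hε]
      refine le_trans ?_ (hnear (c.enc m k) y).1
      refine mul_le_mul (Real.exp_le_exp.2 ?_) (le_mix ht (h.le y) (h'.le y)) hδ.le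
        (Real.exp_pos _).le
      nlinarith [hθ'.2]
    · exact le_one_of_mem_stdSimplex ⟨fun y => (hVp _ y).le, hV1 _⟩ y
    · refine le_trans ?_ (hWδ _ y)
      rw [← hε]
      exact mul_le_of_le_one_left hδ.le (Real.exp_le_one_iff.2 (by linarith))
  · have h1 : ∑ z : Fin n → Y with c.dec z = m, ∏ k, mix t q q' (z k) ≤ 1 / (M * w) := by
      rw [le_div_iff₀ (by positivity)]
      rw [le_div_iff₀ hM] at hw
      linarith
    refine (mul_le_mul_of_nonneg_right h1 (Real.exp_pos _).le).trans ?_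
    have h2 : Real.exp (∑ k, relEnt (mix t (tilt (1 - θ) (W (c.enc m k)) q)
      (tilt (1 - θ') (W (c.enc m k)) q')) (mix t q q') +
      8 * (-2 * Real.log δ * θ') * Real.sqrt n) ≤ M * w / 2 := by
      rw [← Real.le_log_iff_exp_le (by positivity), Real.log_div (by positivity) (by norm_num),
        Real.log_mul hM.ne' hw0.ne']
      linarith
    calc _ ≤ 1 / (M * w) * (M * w / 2) := mul_le_mul_of_nonneg_left h2 (by positivity)
      _ = 1 / 2 := by field_simp

end IsAnchor

end Anchors

/-! ### Square-root grid and weights of its segments -/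

/-- The grid `min (1, √((j + 1) / n))` of tilting parameters. -/
def gridPoint (n j : ℕ) : ℝ := min 1 (Real.sqrt (j + 1) / Real.sqrt n)

section Grid

variable {n : ℕ}

lemma gridPoint_mem (hn : 0 < n) (j : ℕ) : gridPoint n j ∈ Ioc (0 : ℝ) 1 :=
  ⟨lt_min one_pos (by positivity), min_le_left _ _⟩

lemma gridPoint_mono (j : ℕ) : gridPoint n j ≤ gridPoint n (j + 1) :=
  min_le_min_left _ (div_le_div_of_nonneg_right
    (Real.sqrt_le_sqrt (by push_cast; linarith)) (Real.sqrt_nonneg _))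

lemma gridPoint_mul_sqrt_le (hn : 0 < n) (j : ℕ) :
    gridPoint n j * Real.sqrt n ≤ Real.sqrt (j + 1) := by
  have : 0 < Real.sqrt n := by positivity
  exact (le_div_iff₀ this).1 (min_le_right _ _)

lemma mul_gridPoint_sq_le (hn : 0 < n) (j : ℕ) : n * gridPoint n j ^ 2 ≤ j + 1 := by
  have h := pow_le_pow_left₀ (mul_nonneg (gridPoint_mem hn j).1.le (Real.sqrt_nonneg _))
    (gridPoint_mul_sqrt_le hn j) 2
  rw [mul_pow, Real.sq_sqrt (by positivity), Real.sq_sqrt (by positivity)] at h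
  linarith

/-- The slope s/(1-s) times a rate loss of order √(j+1) stays O(√n); this dictates the square-root
spacing. -/
lemma inv_gridPoint_sub_one_mul_le (hn : 0 < n) (j : ℕ) :
    (1 / gridPoint n j - 1) * Real.sqrt (j + 1) ≤ Real.sqrt n := by
  have hr : 0 < Real.sqrt n := by positivity
  have ha : 0 < Real.sqrt ((j : ℝ) + 1) := by positivity
  rcases min_choice 1 (Real.sqrt (j + 1) / Real.sqrt n) with h | h
  · rw [gridPoint, h]
    simp
  · rw [gridPoint, h, one_div_div, sub_mul, div_mul_cancel₀ _ ha.ne']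
    linarith

lemma gridPoint_eq_one (hn : 0 < n) {j : ℕ} (hj : n = j + 1) : gridPoint n j = 1 := by
  subst hj
  rw [gridPoint]
  push_cast
  rw [div_self (by positivity), min_self]

/-- With a = √(j+1) and b = √(j+2) the left side is √n (b-a)b/a, and (b-a)b ≤ b² - a² = 1 ≤ a.
Neither grid point is truncated as j + 2 ≤ n. -/
lemma mul_gridPoint_increment_le {j : ℕ} (hj : j + 2 ≤ n) :
    n * ((1 / gridPoint n j - 1 / gridPoint n (j + 1)) * gridPoint n (j + 1) ^ 2) ≤
      Real.sqrt n := by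
  have hn : 0 < n := by omega
  have hjn : (j : ℝ) + 2 ≤ n := by exact_mod_cast hj
  set r := Real.sqrt n with hr
  set a := Real.sqrt ((j : ℝ) + 1) with ha
  set b := Real.sqrt ((j : ℝ) + 2) with hb
  have hr0 : 0 < r := by positivity
  have ha1 : 1 ≤ a := Real.one_le_sqrt.2 (by linarith [(Nat.cast_nonneg j : (0 : ℝ) ≤ j)])
  have hab : a ≤ b := Real.sqrt_le_sqrt (by linarith)
  have hbr : b ≤ r := Real.sqrt_le_sqrt hjn
  have h1 : gridPoint n j = a / r := min_eq_right ((div_le_one hr0).2 (hab.trans hbr))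
  have h2 : gridPoint n (j + 1) = b / r := by
    rw [gridPoint, show ((j + 1 : ℕ) : ℝ) + 1 = j + 2 by push_cast; ring]
    exact min_eq_right ((div_le_one hr0).2 hbr)
  have ha0 : 0 < a := by linarith
  have hb0 : 0 < b := by linarith
  have hsq : b ^ 2 - a ^ 2 = 1 := by
    rw [ha, hb, Real.sq_sqrt (by positivity), Real.sq_sqrt (by positivity)]; ring
  have hn2 : (n : ℝ) = r ^ 2 := (Real.sq_sqrt (by positivity)).symm
  rw [h1, h2, hn2]
  have : r ^ 2 * ((1 / (a / r) - 1 / (b / r)) * (b / r) ^ 2) = r * ((b - a) * b / a) := by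
    field_simp
  rw [this]
  refine mul_le_of_le_one_right hr0.le ((div_le_one ha0).2 ?_)
  nlinarith

/-- The weight of the `j`-th segment of the grid. -/
def gridWeight (j : ℕ) : ℝ := 1 / ((j + 1) * (j + 2) * (j + 3))

lemma gridWeight_pos (j : ℕ) : 0 < gridWeight j := by
  unfold gridWeight
  positivity

/-- Segment j has j + 3 division points, so its total weight is 1/((j+1)(j+2)) and the sum
telescopes. -/
lemma sum_gridWeight_le (n : ℕ) :
    ∑ i ∈ (Finset.range n).sigma fun j => Finset.range (j + 3), gridWeight i.1 ≤ 1 := by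
  rw [Finset.sum_sigma]
  have h : ∀ n : ℕ, ∑ j ∈ Finset.range n, ∑ _i ∈ Finset.range (j + 3), gridWeight j =
      1 - 1 / (n + 1) := by
    intro n
    induction n with
    | zero => simp
    | succ n ih =>
      rw [Finset.sum_range_succ, ih, Finset.sum_const, Finset.card_range, gridWeight]
      push_cast
      simp only [nsmul_eq_mul]
      push_cast
      field_simp
      ring
  refine (h n).trans_le ?_
  have : (0 : ℝ) ≤ 1 / (n + 1) := by positivity
  linarith

lemma neg_log_gridWeight_le (j : ℕ) :
    -Real.log (gridWeight j) + Real.log 2 ≤ 8 * Real.sqrt (j + 2) := by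
  set r := Real.sqrt ((j : ℝ) + 2) with hr
  have hj : (0 : ℝ) ≤ j := Nat.cast_nonneg j
  have hr1 : 1 ≤ r := Real.one_le_sqrt.2 (by linarith)
  have h2 : Real.log ((j : ℝ) + 2) ≤ 2 * r := by
    have := Real.log_le_sub_one_of_pos (by linarith : 0 < r)
    rw [hr, Real.log_sqrt (by positivity)] at this
    linarith
  have h1 : Real.log ((j : ℝ) + 1) ≤ Real.log (j + 2) :=
    Real.log_le_log (by positivity) (by linarith)
  have hl2 : Real.log 2 ≤ 1 := by
    have := Real.log_le_sub_one_of_pos (by norm_num : (0 : ℝ) < 2)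
    linarith
  have h3 : Real.log ((j : ℝ) + 3) ≤ Real.log 2 + Real.log (j + 2) := by
    rw [← Real.log_mul (by norm_num) (by positivity)]
    exact Real.log_le_log (by positivity) (by linarith)
  rw [gridWeight, one_div, Real.log_inv, neg_neg, Real.log_mul (by positivity) (by positivity),
    Real.log_mul (by positivity) (by positivity)]
  linarith

end Grid

/-! ### Sphere-packing bound for a single code -/

section Core

variable {X Y : Type*} [Fintype X] [Fintype Y] {W : X → Y → ℝ} {δ : ℝ} {E : ℝ → ℝ}

/-- The sphere-packing bound for a single code, in terms of the minimax exponent. -/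
theorem IsMinimaxExponent.exists_lt_errorProb (hE : IsMinimaxExponent W δ E) (hδ : 0 < δ)
    (hδ1 : δ < 1) (hW : ∀ x, W x ∈ stdSimplex ℝ Y) (hWδ : ∀ x y, δ ≤ W x y) :
    ∃ A B : ℝ, 0 ≤ A ∧ 0 ≤ B ∧ ∀ (n M : ℕ) (c : BlockCode X Y n M), 0 < n → A < Real.log M →
      ∃ m, ∃ s ∈ Ico (0 : ℝ) 1,
        Real.exp (-(n * E s - s / (1 - s) * (Real.log M - A) + B * Real.sqrt n)) <
          errorProb W c m := by
  have hlog : Real.log δ < 0 := Real.log_neg hδ hδ1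
  set κ := -2 * Real.log δ with hκ
  have hκ0 : 0 < κ := by linarith
  set K := Real.exp κ - 1 with hK
  have hK0 : 0 < K := by linarith [Real.add_one_lt_exp hκ0.ne']
  set H := 8 * κ + 8 with hH
  have hH0 : 0 < H := by linarith
  set β := -3 * Real.log δ with hβ
  have hβ0 : 0 < β := by linarith
  -- K² + 2H makes the first grid point affordable when log M > A; 4κK bounds the increment between
  -- division points. `B` collects the change of anchor K², the rate loss 2H, the change of measure
  -- 8β, and 2 for the factor 1/4.
  refine ⟨max (K ^ 2 + 2 * H) (4 * κ * K), K ^ 2 + 2 * H + 8 * β + 2,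
    le_max_of_le_left (by positivity), by positivity, fun n M c hn hA => ?_⟩
  set A := max (K ^ 2 + 2 * H) (4 * κ * K) with hAdef
  have hA1 : K ^ 2 + 2 * H ≤ A := le_max_left _ _
  have hA2 : 4 * κ * K ≤ A := le_max_right _ _
  have hn1 : (1 : ℝ) ≤ n := by exact_mod_cast hn
  have hM : 0 < M := by
    rcases Nat.eq_zero_or_pos M with rfl | h
    · simp only [Nat.cast_zero, Real.log_zero] at hA
      linarith [(by positivity : 0 ≤ K ^ 2 + 2 * H)]
    · exact h
  have hr1 : 1 ≤ Real.sqrt n := Real.one_le_sqrt.2 hn1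
  have hθ := gridPoint_mem hn
  choose q hq using fun j => hE.exists_isAnchor (hθ j)
  have ht : ∀ j i : ℕ, i ≤ j + 2 → (i / (j + 2) : ℝ) ∈ Icc (0 : ℝ) 1 := fun j i hi =>
    ⟨by positivity, (div_le_one (by positivity)).2 (by exact_mod_cast hi)⟩
  -- The message is fixed before the division point, which will depend on its codeword.
  obtain ⟨m, hm⟩ := exists_forall_mul_sum_le hM
    ((Finset.range n).sigma fun j => Finset.range (j + 3))
    (w := fun i => gridWeight i.1) (fun i => (gridWeight_pos _).le) (sum_gridWeight_le n)
    (q := fun i => mix (i.2 / (i.1 + 2) : ℝ) (q i.1) (q (i.1 + 1)))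
    (fun i hi y => by
      simp only [Finset.mem_sigma, Finset.mem_range] at hi
      exact (mix_pos (ht _ _ (by omega)) ((hq _).pos hδ y) ((hq _).pos hδ y)).le)
    (fun i => sum_mix (hq _).mem.2 (hq _).mem.2 _) c.dec
  refine ⟨m, ?_⟩
  set V : ℕ → Fin n → Y → ℝ := fun j k => tilt (1 - gridPoint n j) (W (c.enc m k)) (q j) with hV
  set g : ℕ → ℝ → ℝ := fun j t =>
    ∑ k, relEnt (mix t (V j k) (V (j + 1) k)) (mix t (q j) (q (j + 1))) with hg
  set e : ℕ → ℝ → ℝ := fun j t =>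
    ∑ k, relEnt (mix t (V j k) (V (j + 1) k)) (W (c.enc m k)) with he
  have hkey : ∀ j i : ℕ, j < n → i ≤ j + 2 →
      g j (i / (j + 2)) + H * Real.sqrt (j + 2) ≤ Real.log M →
      1 / 4 * Real.exp (-(e j (i / (j + 2)) + 8 * β * Real.sqrt n)) ≤ errorProb W c m := by
    intro j i hj hi hgM
    refine (hq j).le_errorProb (hq (j + 1)) hδ hδ1 hW hWδ (hθ j) (hθ (j + 1)) (gridPoint_mono j)
      (ht j i hi) hn c m (gridWeight_pos j)
      (hm ⟨j, i⟩ (by simp only [Finset.mem_sigma, Finset.mem_range]; omega)) ?_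
    have h1 := gridPoint_mul_sqrt_le hn (j + 1)
    have h2 := neg_log_gridWeight_le j
    rw [show ((j + 1 : ℕ) : ℝ) + 1 = j + 2 by push_cast; ring] at h1
    have h3 := mul_le_mul_of_nonneg_left h1 (by positivity : 0 ≤ 8 * κ)
    change g j (i / (j + 2)) + 8 * (κ * gridPoint n (j + 1)) * Real.sqrt n
      - Real.log (gridWeight j) + Real.log 2 ≤ Real.log M
    have h4 : H * Real.sqrt (j + 2) = 8 * κ * Real.sqrt (j + 2) + 8 * Real.sqrt (j + 2) := by
      rw [hH]; ring
    linarith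
  have hquarter : ∀ x : ℝ, Real.exp (-(x + 2 * Real.sqrt n)) < 1 / 4 * Real.exp (-x) := by
    intro x
    rw [neg_add, Real.exp_add, mul_comm]
    refine mul_lt_mul_of_pos_right ?_ (Real.exp_pos _)
    have h1 : (4 : ℝ) < Real.exp (2 * Real.sqrt n) := by
      have := Real.quadratic_le_exp_of_nonneg (by positivity : 0 ≤ 2 * Real.sqrt n)
      nlinarith
    rw [Real.exp_neg, one_div]
    exact inv_strictAnti₀ (by norm_num) h1
  have hg0 : ∀ j, g j 0 = ∑ k, relEnt (V j k) (q j) := fun j => by simp only [hg, mix_zero]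
  have hg1 : ∀ j, g j 1 = ∑ k, relEnt (V (j + 1) k) (q (j + 1)) := fun j => by
    simp only [hg, mix_one]
  -- The rate may be so large that even θ = 1 is affordable; then s = 0 suffices.
  by_cases hlast : g (n - 1) 0 + H * Real.sqrt ((n - 1 : ℕ) + 2) ≤ Real.log M
  · refine ⟨0, ⟨le_rfl, one_pos⟩, ?_⟩
    have h1 := hkey (n - 1) 0 (by omega) (by omega) (by simpa using hlast)
    refine lt_of_lt_of_le ?_ h1
    refine lt_of_le_of_lt ?_ (hquarter _)
    have hone : gridPoint n (n - 1) = 1 := gridPoint_eq_one hn (by omega)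
    have h2 : e (n - 1) 0 ≤ n * E 0 := by
      simp only [he, mix_zero]
      calc _ ≤ ∑ _k : Fin n, E 0 := Finset.sum_le_sum fun k _ => by
            have := (hq (n - 1)).relEnt_add_le hδ hWδ (hθ _) (c.enc m k)
            rw [hone] at this
            simp only [hV, hone]
            simpa using this
        _ = n * E 0 := by simp
    have h3 : e (n - 1) ((0 : ℕ) / ((n - 1 : ℕ) + 2)) = e (n - 1) 0 := by simp
    rw [h3]
    refine Real.exp_le_exp.2 (neg_le_neg ?_)
    rw [zero_div, zero_mul, sub_zero]
    have : 0 ≤ (K ^ 2 + 2 * H) * Real.sqrt n := by positivity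
    linarith
  · have hfirst : g 0 0 + H * Real.sqrt ((0 : ℕ) + 2) ≤ Real.log M := by
      have h1 : g 0 0 ≤ K ^ 2 := by
        rw [hg0]
        calc _ ≤ ∑ _k : Fin n, (K * gridPoint n 0) ^ 2 := Finset.sum_le_sum fun k _ =>
              (hq 0).relEnt_tilt_le hδ hW hWδ (hθ 0) (c.enc m k)
          _ = K ^ 2 * (n * gridPoint n 0 ^ 2) := by simp; ring
          _ ≤ K ^ 2 * 1 := mul_le_mul_of_nonneg_left
              (by simpa using mul_gridPoint_sq_le hn 0) (by positivity)
          _ = K ^ 2 := mul_one _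
      have h2 : Real.sqrt ((0 : ℕ) + 2) ≤ 2 := by
        rw [Real.sqrt_le_left (by norm_num)]; norm_num
      have := mul_le_mul_of_nonneg_left h2 hH0.le
      linarith
    obtain ⟨j, hj, hPj, hPj'⟩ := exists_lt_and_not_succ
      (P := fun j => g j 0 + H * Real.sqrt (j + 2) ≤ Real.log M) hfirst hlast
    have hj2 : (0 : ℝ) < (j : ℝ) + 2 := by positivity
    have hj3 : Real.sqrt ((j : ℝ) + 2) ≤ Real.sqrt ((j + 1 : ℕ) + 2) :=
      Real.sqrt_le_sqrt (by push_cast; linarith)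
    -- The last affordable division point has g close to log M. If the right end is affordable, it
    -- works too: it starts segment j + 1, whose larger margin is not affordable.
    have hex : ∃ i ≤ j + 2, g j (i / (j + 2)) + H * Real.sqrt (j + 2) ≤ Real.log M ∧
        Real.log M - H * Real.sqrt ((j + 1 : ℕ) + 2) - A ≤ g j (i / (j + 2)) := by
      by_cases hend : g j 1 + H * Real.sqrt (j + 2) ≤ Real.log M
      · refine ⟨j + 2, le_rfl, ?_⟩
        push_cast
        rw [div_self hj2.ne']
        refine ⟨hend, ?_⟩
        rw [hg1 j, ← hg0 (j + 1)]
        push_cast at hPj'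
        linarith [(by positivity : 0 ≤ 4 * κ * K)]
      · obtain ⟨i, hi, hi1, hi2⟩ := exists_lt_and_not_succ
          (P := fun i : ℕ => g j (i / (j + 2)) + H * Real.sqrt (j + 2) ≤ Real.log M)
          (N := j + 2) (by simpa using hPj) (by push_cast; rwa [div_self hj2.ne'])
        refine ⟨i, hi.le, hi1, ?_⟩
        have hstep : g j ((i + 1 : ℕ) / (j + 2)) - g j (i / (j + 2)) ≤ 4 * κ * K := by
          simp only [hg, hV]
          rw [← Finset.sum_sub_distrib]
          calc _ ≤ ∑ _k : Fin n, (((i + 1 : ℕ) / (j + 2) : ℝ) - i / (j + 2)) * (4 * κ * K) *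
                gridPoint n (j + 1) ^ 2 := Finset.sum_le_sum fun k _ =>
                (hq j).relEnt_mix_step_le (hq (j + 1)) hδ hW hWδ (hθ j) (hθ (j + 1))
                  (gridPoint_mono j) (ht j i hi.le) (ht j (i + 1) hi)
                  (div_le_div_of_nonneg_right (by push_cast; linarith) hj2.le) _
            _ = 4 * κ * K * (n * gridPoint n (j + 1) ^ 2 / (j + 2)) := by
                rw [Finset.sum_const, Finset.card_univ, Fintype.card_fin, nsmul_eq_mul]
                push_cast
                ring
            _ ≤ 4 * κ * K * 1 := by
                refine mul_le_mul_of_nonneg_left ((div_le_one hj2).2 ?_) (by positivity)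
                have := mul_gridPoint_sq_le hn (j + 1)
                push_cast at this
                linarith
            _ = 4 * κ * K := mul_one _
        have := mul_le_mul_of_nonneg_left hj3 hH0.le
        have hi2' := not_le.1 hi2
        linarith
    obtain ⟨i, hi, hgle, hgge⟩ := hex
    set θ' := gridPoint n (j + 1) with hθ'
    have hθ'0 := hθ (j + 1)
    rw [← hθ'] at hθ'0
    refine ⟨1 - θ', ⟨by linarith [hθ'0.2], by linarith [hθ'0.1]⟩, ?_⟩
    refine lt_of_lt_of_le ?_ (hkey j i (by omega) hi hgle)
    refine lt_of_le_of_lt ?_ (hquarter _)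
    refine Real.exp_le_exp.2 (neg_le_neg ?_)
    have hρ : 0 ≤ 1 / θ' - 1 := by
      rw [sub_nonneg, one_le_div hθ'0.1]; exact hθ'0.2
    have hs : (1 - θ') / (1 - (1 - θ')) = 1 / θ' - 1 := by
      rw [sub_sub_cancel, sub_div, div_self hθ'0.1.ne']
    have hsum : e j (i / (j + 2)) + (1 / θ' - 1) * g j (i / (j + 2)) ≤
        n * E (1 - θ') + K ^ 2 * Real.sqrt n := by
      simp only [he, hg]
      rw [Finset.mul_sum, ← Finset.sum_add_distrib]
      calc _ ≤ ∑ _k : Fin n, (E (1 - θ') +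
            (1 / gridPoint n j - 1 / θ') * (K * θ') ^ 2) := Finset.sum_le_sum fun k _ =>
            (hq j).relEnt_mix_add_le (hq (j + 1)) hE hδ hW hWδ (hθ j) (hθ (j + 1))
              (gridPoint_mono j) (ht j i hi) (c.enc m k)
        _ = n * E (1 - θ') + K ^ 2 * (n * ((1 / gridPoint n j - 1 / θ') * θ' ^ 2)) := by
            rw [Finset.sum_const, Finset.card_univ, Fintype.card_fin, nsmul_eq_mul]
            ring
        _ ≤ _ := by
            gcongr
            exact mul_gridPoint_increment_le (by omega)
    have hloss : (1 / θ' - 1) * (H * Real.sqrt ((j + 1 : ℕ) + 2)) ≤ 2 * H * Real.sqrt n := by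
      have h1 := inv_gridPoint_sub_one_mul_le hn (j + 1)
      have h2 : Real.sqrt ((j + 1 : ℕ) + 2) ≤ 2 * Real.sqrt ((j + 1 : ℕ) + 1) := by
        rw [Real.sqrt_le_left (by positivity), mul_pow, Real.sq_sqrt (by positivity)]
        push_cast
        linarith
      calc _ ≤ (1 / θ' - 1) * (H * (2 * Real.sqrt ((j + 1 : ℕ) + 1))) := by gcongr
        _ = 2 * H * ((1 / θ' - 1) * Real.sqrt ((j + 1 : ℕ) + 1)) := by ring
        _ ≤ _ := by gcongr
    have hfin := mul_le_mul_of_nonneg_left hgge hρ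
    rw [hs]
    linarith

end Core

/-! ### Elementary bounds on error probabilities; negative rates -/

section ErrorProb

variable {X Y : Type*} [Fintype Y] {W : X → Y → ℝ}

lemma errorProb_le_one (hW : ∀ x, W x ∈ stdSimplex ℝ Y) {n M : ℕ} (c : BlockCode X Y n M)
    (m : Fin M) : errorProb W c m ≤ 1 := by
  calc errorProb W c m ≤ ∑ z : Fin n → Y, ∏ k, W (c.enc m k) (z k) :=
        Finset.sum_le_sum_of_subset_of_nonneg (Finset.filter_subset _ _) fun z _ _ =>
          Finset.prod_nonneg fun k _ => (hW _).1 _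
    _ = 1 := by rw [sum_prod_apply fun k => W (c.enc m k)]; simp [(hW _).2]

lemma errorProb_le_maxErrorProb {n M : ℕ} (c : BlockCode X Y n M) (m : Fin M) :
    errorProb W c m ≤ maxErrorProb W c :=
  le_ciSup (f := fun m => errorProb W c m) (finite_range _).bddAbove m

lemma maxErrorProb_pos [Nonempty Y] (hW : ∀ x y, 0 < W x y) {n M : ℕ} (c : BlockCode X Y n M)
    (hM : 2 ≤ M) : 0 < maxErrorProb W c := by
  have : Nontrivial (Fin M) := Fin.nontrivial_iff_two_le.2 hM
  let z : Fin n → Y := fun _ => Classical.arbitrary Y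
  obtain ⟨m, hm⟩ := exists_ne (c.dec z)
  refine lt_of_lt_of_le ?_ (errorProb_le_maxErrorProb c m)
  exact Finset.sum_pos (fun z _ => Finset.prod_pos fun k _ => hW _ _)
    ⟨z, Finset.mem_filter.2 ⟨Finset.mem_univ z, hm.symm⟩⟩

lemma exists_pos_lt_one_le [Finite X] (hW : ∀ x y, 0 < W x y) :
    ∃ δ : ℝ, 0 < δ ∧ δ < 1 ∧ ∀ x y, δ ≤ W x y := by
  rcases isEmpty_or_nonempty (X × Y) with h | h
  · exact ⟨1 / 2, by norm_num, by norm_num, fun x y => isEmptyElim (x, y)⟩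
  · obtain ⟨p, hp⟩ := Finite.exists_min fun p : X × Y => W p.1 p.2
    exact ⟨min (W p.1 p.2) (1 / 2), lt_min (hW _ _) (by norm_num),
      (min_le_right _ _).trans_lt (by norm_num), fun x y => (min_le_left _ _).trans (hp (x, y))⟩

end ErrorProb

section Exponent

variable {X Y : Type*} [Fintype X] [Fintype Y] {W : X → Y → ℝ} {δ : ℝ} {E : ℝ → ℝ}
  {a b : ℝ} {ψ : ℝ → ℝ → ℝ}

/-- E is nonnegative and the slope s/(1-s) is unbounded; s = t/(1+t) has slope t. -/
lemma IsMinimaxExponent.spExponent_eq_top [Nonempty X] (hE : IsMinimaxExponent W δ E)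
    (hδ : 0 < δ) (hW : ∀ x, W x ∈ stdSimplex ℝ Y) (hWδ : ∀ x y, δ ≤ W x y) (ha : 0 < a)
    (hψ : Admissible a b ψ) {R : ℝ} (hR : R < 0) : spExponent ψ W R = ⊤ := by
  rw [EReal.eq_top_iff_forall_lt]
  intro y
  set t := (|y| + 1) / -R with ht
  have ht0 : 0 < t := div_pos (by positivity) (by linarith)
  have hs : t / (1 + t) ∈ Ico (0 : ℝ) 1 :=
    ⟨by positivity, (div_lt_one (by positivity)).2 (by linarith)⟩
  refine lt_of_lt_of_le (EReal.coe_lt_coe_iff.2 ?_) (hE.le_spExponent _ hs a b ψ ha hψ R)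
  have h1 := hE.nonneg hδ hW hWδ hs
  have h2 : t / (1 + t) / (1 - t / (1 + t)) = t := by
    have : 1 - t / (1 + t) = 1 / (1 + t) := by field_simp; ring
    rw [this]
    field_simp
  have h3 : t * R = -(|y| + 1) := by
    rw [ht]; field_simp [hR.ne]
  rw [h2, h3]
  linarith [le_abs_self y]

end Exponent

end SpherePacking

end

/-! ### Assembly of the two claims -/

theorem mainTheorem11 {X Y : Type*} [Fintype X] [Fintype Y]
    (W : X → Y → ℝ) (hW : ∀ x, W x ∈ stdSimplex ℝ Y) (hWpos : ∀ x y, 0 < W x y)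
    (a b : ℝ) (ha : 0 < a) (hab : a < b) :
    ∃ A B : ℝ, ∀ ψ : ℝ → ℝ → ℝ, SpherePacking.Admissible a b ψ →
      (∀ (n M : ℕ) (c : SpherePacking.BlockCode X Y n M),
        0 < n → 0 < SpherePacking.codeRate n M →
        EReal.exp (-((n : EReal) *
            (SpherePacking.spExponent ψ W (SpherePacking.codeRate n M - A / n)
              + ((B / Real.sqrt n : ℝ) : EReal))))
          < ENNReal.ofReal (SpherePacking.maxErrorProb W c)) ∧
      (∀ R : ℝ, 0 < R →
        SpherePacking.reliability W R ≤ SpherePacking.spExponent ψ W R) := by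
  open SpherePacking in
  have hM2 : ∀ {n M : ℕ}, 0 < codeRate n M → 2 ≤ M := by
    intro n M h
    by_contra! hM
    have : M = 0 ∨ M = 1 := by omega
    rcases this with rfl | rfl <;> simp [codeRate] at h
  rcases isEmpty_or_nonempty X with hX | hX
  · refine ⟨0, 0, fun ψ _ => ⟨fun n M c hn hR => ?_, fun R _ => ?_⟩⟩
    · exact isEmptyElim (c.enc ⟨0, by have := hM2 hR; omega⟩ ⟨0, hn⟩)
    · refine limsup_le_of_le (h := ?_)
      filter_upwards [eventually_gt_atTop 0] with n hn
      refine iSup_le fun M => iSup₂_le fun hM c => ?_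
      have hM0 : 0 < M := by exact_mod_cast (Real.exp_pos _).trans_le hM
      exact isEmptyElim (c.enc ⟨0, hM0⟩ ⟨0, hn⟩)
  obtain ⟨δ, hδ, hδ1, hWδ⟩ := exists_pos_lt_one_le hWpos
  have hY : Nonempty Y := by
    by_contra hne
    rw [not_nonempty_iff] at hne
    simpa using (hW (Classical.arbitrary X)).2
  obtain ⟨E, hE⟩ := exists_isMinimaxExponent hδ hδ1.le hW hWδ
  obtain ⟨A, B, hA, hB, hcore⟩ := hE.exists_lt_errorProb hδ hδ1 hW hWδ
  -- The extra 1 makes the shifted rate strictly negative whenever log M ≤ A. The exponent is then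
  -- infinite and only positivity of the error remains.
  refine ⟨A + 1, B, fun ψ hψ => ⟨fun n M c hn hR => ?_, fun R hR => ?_⟩⟩
  · have hn0 : (0 : ℝ) < n := by exact_mod_cast hn
    have hr0 : 0 < Real.sqrt n := by positivity
    have hMpos := maxErrorProb_pos hWpos c (hM2 hR)
    have hRn : codeRate n M * n = Real.log M := by rw [codeRate]; field_simp
    rcases lt_or_ge A (Real.log M) with hlt | hge
    · obtain ⟨m, s, hs, hm⟩ := hcore n M c hn hlt
      have hS := hE.le_spExponent s hs a b ψ ha hψ (codeRate n M - (A + 1) / n)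
      have hρ : 0 ≤ s / (1 - s) := div_nonneg hs.1 (by linarith [hs.2])
      set v := E s - s / (1 - s) * (codeRate n M - (A + 1) / n) with hv
      have h1 : ((n * (v + B / Real.sqrt n) : ℝ) : EReal) ≤ (n : EReal) *
          (spExponent ψ W (codeRate n M - (A + 1) / n) + ((B / Real.sqrt n : ℝ) : EReal)) := by
        rw [EReal.coe_mul, EReal.coe_add]
        exact mul_le_mul_of_nonneg_left (add_le_add_left hS _) (by positivity)
      refine (EReal.exp_monotone (EReal.neg_le_neg_iff.2 h1)).trans_lt ?_
      rw [← EReal.coe_neg, EReal.exp_coe, ENNReal.ofReal_lt_ofReal_iff hMpos]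
      refine lt_of_le_of_lt (Real.exp_le_exp.2 (neg_le_neg ?_))
        (hm.trans_le (errorProb_le_maxErrorProb c m))
      have e1 : n * (v + B / Real.sqrt n) =
          n * E s - s / (1 - s) * (Real.log M - A) + s / (1 - s) + B * Real.sqrt n := by
        have h2 : n / Real.sqrt n = Real.sqrt n := Real.div_sqrt
        have h3 : n * (B / Real.sqrt n) = B * Real.sqrt n := by
          rw [mul_div_assoc', mul_comm, mul_div_assoc, h2]
        rw [mul_add, h3, hv, ← hRn]
        field_simp
        ring
      linarith
    · have hneg : codeRate n M - (A + 1) / n < 0 := by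
        rw [sub_neg, lt_div_iff₀ hn0, hRn]
        linarith
      rw [hE.spExponent_eq_top hδ hW hWδ ha hψ hneg, EReal.top_add_coe,
        EReal.mul_top_of_pos (by exact_mod_cast hn), EReal.neg_top, EReal.exp_bot]
      exact ENNReal.ofReal_pos.2 hMpos
  · have hS0 : (0 : EReal) ≤ spExponent ψ W R := by
      refine le_trans ?_ (hE.le_spExponent 0 ⟨le_rfl, one_pos⟩ a b ψ ha hψ R)
      have := hE.nonneg hδ hW hWδ (s := 0) ⟨le_rfl, one_pos⟩
      simpa using this
    rcases eq_or_ne (spExponent ψ W R) ⊤ with hT | hT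
    · rw [hT]; exact le_top
    obtain ⟨S, hS⟩ : ∃ S : ℝ, spExponent ψ W R = S :=
      ⟨_, (EReal.coe_toReal hT (EReal.bot_lt_zero.trans_le hS0).ne').symm⟩
    rw [hS]
    set C := -Real.log δ with hC
    have hC0 : 0 < C := by linarith [Real.log_neg hδ hδ1]
    set D := 2 * (C + B) / R * A + B with hD
    have hlim : Tendsto (fun n : ℕ => ((S + D / Real.sqrt n : ℝ) : EReal)) atTop
        (nhds (S : EReal)) := by
      refine (continuous_coe_real_ereal.tendsto _).comp ?_
      have : Tendsto (fun n : ℕ => D / Real.sqrt n) atTop (nhds 0) :=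
        tendsto_const_nhds.div_atTop (Real.tendsto_sqrt_atTop.comp tendsto_natCast_atTop_atTop)
      simpa using this.const_add S
    rw [← hlim.limsup_eq]
    refine limsup_le_limsup ?_
    filter_upwards [eventually_gt_atTop 0,
      tendsto_natCast_atTop_atTop.eventually_gt_atTop (2 * A / R)] with n hn hnA
    refine iSup_le fun M => iSup₂_le fun hM c => ?_
    have hn1 : (1 : ℝ) ≤ n := by exact_mod_cast hn
    have hr1 : 1 ≤ Real.sqrt n := Real.one_le_sqrt.2 hn1
    have hM0 : (0 : ℝ) < M := (Real.exp_pos _).trans_le hM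
    have hlogM : n * R ≤ Real.log M := (Real.le_log_iff_exp_le hM0).2 hM
    have hnA' : 2 * A < n * R := (div_lt_iff₀ hR).1 hnA
    obtain ⟨m, s, hs, hm⟩ := hcore n M c hn (by linarith)
    have hP := hm.trans_le (errorProb_le_maxErrorProb c m)
    have hPpos := (Real.exp_pos _).trans hP
    have hρ : 0 ≤ s / (1 - s) := div_nonneg hs.1 (by linarith [hs.2])
    set ρ := s / (1 - s) with hρdef
    set x := n * E s - ρ * (Real.log M - A) + B * Real.sqrt n with hx
    -- An error probability is at most 1, so the exponent is positive. This bounds the slope ρ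
    -- independently of n, hence the shift by `A` costs only O(1).
    have hx0 : 0 < x := by
      have := hm.trans_le (errorProb_le_one hW c m)
      rw [Real.exp_lt_one_iff] at this
      linarith
    have hEC := mul_le_mul_of_nonneg_left (hE.le_neg_log hδ hW hWδ hs) (by positivity : (0:ℝ) ≤ n)
    have hρle : ρ ≤ 2 * (C + B) / R := by
      rw [le_div_iff₀ hR]
      have h1 := mul_le_mul_of_nonneg_left (by linarith : n * R / 2 ≤ Real.log M - A) hρ
      have h2 : B * Real.sqrt n ≤ B * n := by
        refine mul_le_mul_of_nonneg_left ?_ hB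
        exact (Real.sqrt_le_left (by positivity)).2 (by nlinarith)
      have h3 : n * (ρ * R) ≤ n * (2 * (C + B)) := by linarith
      exact le_of_mul_le_mul_left h3 (by linarith)
    have hSs : E s - ρ * R ≤ S :=
      EReal.coe_le_coe_iff.1 (hS ▸ hE.le_spExponent s hs a b ψ ha hψ R)
    have hxle : x ≤ n * S + D * Real.sqrt n := by
      have h1 := mul_le_mul_of_nonneg_left hSs (by positivity : (0:ℝ) ≤ n)
      have h2 := mul_le_mul_of_nonneg_left hlogM hρ
      have h3 : ρ * A ≤ 2 * (C + B) / R * A * Real.sqrt n := by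
        refine (mul_le_mul_of_nonneg_right hρle hA).trans (le_mul_of_one_le_right ?_ hr1)
        positivity
      rw [hD, hx]
      linarith
    have hlogP : -Real.log (maxErrorProb W c) ≤ x := by
      have := (Real.lt_log_iff_exp_lt hPpos).2 hP
      linarith
    rw [ENNReal.log_ofReal_of_pos hPpos, ← EReal.coe_neg, ← EReal.coe_natCast, ← EReal.coe_div,
      EReal.coe_le_coe_iff, div_le_iff₀ (by linarith)]
    have : (S + D / Real.sqrt n) * n = n * S + D * Real.sqrt n := by
      have h2 : n / Real.sqrt n = Real.sqrt n := Real.div_sqrt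
      linear_combination D * h2
    linarith
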